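/- Let $p$ be a prime. All subgroups of pro-$p$ groups below are closed, generation is topological, and homomorphisms are continuous. For a pro-$p$ group $G$ let $G^m$ be the subgroup generated by all $m$-th powers, and put $P_1(G)=G$, $P_{i+1}(G)=P_i(G)^p[P_i(G),G]$. Call $G$ \emph{uniform} if it is finitely generated, powerful (that is, $[G,G]\le G^p$ if $p$ is odd, and $[G,G]\le G^4$ if $p=2$), and $|P_i(G):P_{i+1}(G)|=|G:P_2(G)|$ for all $i\ge 1$. A \emph{basis} of a finitely generated pro-$p$ group is a system of generators with the minimal possible number of elements. Let $1\le d\le k\le n$ be integers and let $G_1$, $G_2$ and $H$ be uniform pro-$p$ groups, together with injective homomorphisms $\varphi_1\colon H\to G_1$ and $\varphi_2\colon H\to G_2$. Suppose that $G_1$ has a basis $x_1,\dots,x_k$, that $G_2$ has a basis $y_d,\dots,y_n$, and that $H$ is generated by elements $z_d,\dots,z_k$ with $\varphi_1(z_i)=x_i$ and $\varphi_2(z_i)=y_i$ for $d\le i\le k$. (Identifying $z_i$, $x_i$ and $y_i$, one has $G_1=\langle x_1,\dots,x_k\rangle$, $G_2=\langle x_d,\dots,x_n\rangle$ and $H=\langle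 x_d,\dots,x_k\rangle$.) Then the amalgamated free pro-$p$ product $G=G_1\amalg_H G_2$, i.e. the pushout of $\varphi_1$ and $\varphi_2$ in the category of pro-$p$ groups, exists and is proper: the canonical homomorphisms $\psi_1\colon G_1\to G$ and $\psi_2\colon G_2\to G$ are injective. -/

import Mathlib

open CategoryTheory

universe u

section GroupNotions

variable {G : Type*} [Group G] [TopologicalSpace G] [IsTopologicalGroup G]

/-- The closed subgroup of `G` generated (topologically) by the set `S`. -/
def closedSpan (S : Set G) : Subgroup G :=
  (Subgroup.closure S).topologicalClosure

/-- `A ^ m`: the closed subgroup generated by the `m`-th powers of the elements of `A`. -/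
def closedPower (A : Subgroup G) (m : ℕ) : Subgroup G :=
  closedSpan ((fun g : G => g ^ m) '' (A : Set G))

/-- `[A, B]`: the closed subgroup generated by the commutators of elements of `A` and `B`. -/
def closedCommutator (A B : Subgroup G) : Subgroup G :=
  (⁅A, B⁆).topologicalClosure

/-- The descending `p`-central series: `lowerPCentral p G i` is `P_{i+1}(G)`, that is
`P_1(G) = G` and `P_{n+1}(G) = P_n(G)^p [P_n(G), G]` (a closed subgroup). -/
def lowerPCentral (p : ℕ) (G : Type*) [Group G] [TopologicalSpace G] [IsTopologicalGroup G] :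
    ℕ → Subgroup G
  | 0 => ⊤
  | i + 1 => (closedPower (lowerPCentral p G i) p ⊔
      closedCommutator (lowerPCentral p G i) ⊤).topologicalClosure

/-- `G` is powerful: `[G, G] ≤ G^p` for odd `p`, and `[G, G] ≤ G^4` for `p = 2`. -/
def IsPowerfulGroup (p : ℕ) (G : Type*) [Group G] [TopologicalSpace G] [IsTopologicalGroup G] :
    Prop :=
  closedCommutator (⊤ : Subgroup G) ⊤ ≤ closedPower ⊤ (if p = 2 then 4 else p)

/-- A (pro-`p`) group is uniform if it is topologically finitely generated, powerful, and
`|P_i(G) : P_{i+1}(G)| = |G : P_2(G)|` for all `i ≥ 1`. -/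
structure IsUniformProPGroup (p : ℕ) (G : Type*) [Group G] [TopologicalSpace G]
    [IsTopologicalGroup G] : Prop where
  finitelyGenerated : ∃ S : Finset G, closedSpan (S : Set G) = ⊤
  powerful : IsPowerfulGroup p G
  index_eq : ∀ i : ℕ,
    (lowerPCentral p G (i + 1)).relIndex (lowerPCentral p G i) = (lowerPCentral p G 1).index

/-- The family `(x i)`, `i ∈ I`, is a basis (minimal system of topological generators) of `G`:
it generates `G`, and `G` cannot be generated by fewer than `|I|` elements. -/
structure IsGeneratingBasis (I : Finset ℕ) (x : ℕ → G) : Prop where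
  generates : closedSpan (x '' (I : Set ℕ)) = ⊤
  card_le : ∀ S : Finset G, closedSpan (S : Set G) = ⊤ → I.card ≤ S.card

end GroupNotions

/-- A profinite group is pro-`p` if its quotients by open normal subgroups are `p`-groups. -/
def IsProP (p : ℕ) : ObjectProperty ProfiniteGrp.{u} :=
  fun G => ∀ U : OpenNormalSubgroup G, IsPGroup p (G ⧸ U.toSubgroup)

/-- The category of pro-`p` groups and continuous homomorphisms. -/
abbrev ProPGrp (p : ℕ) := (IsProP.{u} p).FullSubcategory

/-- The continuous homomorphism underlying a morphism of pro-`p` groups. -/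
def ProPGrp.toHom {p : ℕ} {A B : ProPGrp.{u} p} (f : A ⟶ B) : A.obj →ₜ* B.obj :=
  f.hom.hom

/-- The amalgamated free pro-`p` product of `G₁` and `G₂` along `φ₁ : H ⟶ G₁`, `φ₂ : H ⟶ G₂`,
i.e. the pushout in the category of pro-`p` groups, exists and is proper: the canonical
homomorphisms of `G₁` and `G₂` to it are injective. -/
def AmalgamIsProper {p : ℕ} {H G₁ G₂ : ProPGrp.{u} p} (φ₁ : H ⟶ G₁) (φ₂ : H ⟶ G₂) : Prop :=
  (∃ (G : ProPGrp.{u} p) (ψ₁ : G₁ ⟶ G) (ψ₂ : G₂ ⟶ G), IsPushout φ₁ φ₂ ψ₁ ψ₂) ∧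
  ∀ (G : ProPGrp.{u} p) (ψ₁ : G₁ ⟶ G) (ψ₂ : G₂ ⟶ G), IsPushout φ₁ φ₂ ψ₁ ψ₂ →
    Function.Injective (ProPGrp.toHom ψ₁) ∧ Function.Injective (ProPGrp.toHom ψ₂)

/-! Write `P i` for `lowerPCentral p G i`. Properness follows once `G₁` and `G₂` have, for every
`m`, homomorphisms to a common finite `p`-group that agree on `H` and have kernels `P m`. These
factor through the pushout, so the kernels of `ψ₁` and `ψ₂` lie in every `P m`, and the `P m`
intersect trivially.

The finite amalgams come from Higman's criterion (`exists_isPGroup_amalgam`): two finite `p`-groups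
with `p`-central filtrations inducing the same filtration on a common subgroup embed compatibly in a
finite `p`-group. That group acts on a fibre product of `A` and `B` over `H`, formed along
`H`-equivariant retractions respecting the layers. Both groups then act by permutations that are
triangular for the product filtration, and such permutations form a `p`-group.

The criterion applies because the series of `G₁` and of `G₂` both restrict to that of `H`
(`comap_lowerPCentral_of_basis`). On the first layer this is linear independence of a basis modulo
`P 1`. It passes to deeper layers because in a uniform group the `p`-power map carries each layer
isomorphically onto the next: powerfulness makes it a surjective homomorphism, and equality of
orders makes it injective. -/

/-! ### `p`-central filtrations and splittings of their layers. -/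

section Filtrations

/-- A descending filtration of a group by subgroups whose successive quotients are central and
of exponent dividing `p`. -/
structure IsPCentralFiltration (p : ℕ) {A : Type*} [Group A] (F : ℕ → Subgroup A) : Prop where
  zero : F 0 = ⊤
  anti : Antitone F
  comm : ∀ j, ∀ x ∈ F j, ∀ g, g * x * g⁻¹ * x⁻¹ ∈ F (j + 1)
  pow : ∀ j, ∀ x ∈ F j, x ^ p ∈ F (j + 1)

namespace IsPCentralFiltration

variable {p : ℕ} {A B H : Type*} [Group A] [Group B] [Group H]
  {F : ℕ → Subgroup A} {E : ℕ → Subgroup B}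

theorem normal (hF : IsPCentralFiltration p F) (j : ℕ) : (F j).Normal where
  conj_mem x hx g := by
    have := (F j).mul_mem (hF.anti j.le_succ (hF.comm j x hx g)) hx
    simpa using this

theorem comap (hF : IsPCentralFiltration p F) (φ : H →* A) :
    IsPCentralFiltration p fun j => (F j).comap φ where
  zero := by simp [hF.zero]
  anti _ _ h := Subgroup.comap_mono (hF.anti h)
  comm j x hx g := by simpa using hF.comm j _ hx (φ g)
  pow j x hx := by simpa using hF.pow j _ hx

theorem map (hF : IsPCentralFiltration p F) (φ : A →* B) (hφ : Function.Surjective φ) :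
    IsPCentralFiltration p fun j => (F j).map φ where
  zero := by simp [hF.zero, Subgroup.map_top_of_surjective φ hφ]
  anti _ _ h := Subgroup.map_mono (hF.anti h)
  comm j := by
    rintro _ ⟨x, hx, rfl⟩ g
    obtain ⟨g, rfl⟩ := hφ g
    exact ⟨_, hF.comm j x hx g, by simp⟩
  pow j := by
    rintro _ ⟨x, hx, rfl⟩
    exact ⟨_, hF.pow j x hx, by simp⟩

theorem prod (hF : IsPCentralFiltration p F) (hE : IsPCentralFiltration p E) :
    IsPCentralFiltration p fun j => (F j).prod (E j) where
  zero := by simp [hF.zero, hE.zero]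
  anti _ _ h := Subgroup.prod_mono (hF.anti h) (hE.anti h)
  comm j x hx g := ⟨hF.comm j _ hx.1 g.1, hE.comm j _ hx.2 g.2⟩
  pow j x hx := ⟨hF.pow j _ hx.1, hE.pow j _ hx.2⟩

theorem mk_comm (hF : IsPCentralFiltration p F) {j : ℕ} {x : A} (hx : x ∈ F j) (g : A) :
    haveI := hF.normal
    (g : A ⧸ F (j + 1)) * (x : A ⧸ F (j + 1)) = x * g := by
  have := hF.normal
  have h := (QuotientGroup.eq_one_iff _).2 (hF.comm j x hx g)
  simp only [QuotientGroup.mk_mul, QuotientGroup.mk_inv] at h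
  rw [mul_inv_eq_one, mul_inv_eq_iff_eq_mul] at h
  exact h

theorem mk_eq_of_le (hF : IsPCentralFiltration p F) {i j : ℕ} (hij : i ≤ j) {x y : A}
    (h : (x : A ⧸ F j) = y) : (x : A ⧸ F i) = y :=
  QuotientGroup.eq.2 (hF.anti hij (QuotientGroup.eq.1 h))

end IsPCentralFiltration

/-- Abelian groups of exponent `p` are vector spaces over `ZMod p`, and a subspace has a complement.
-/
theorem MonoidHom.exists_retraction_of_exponent {p : ℕ} [Fact p.Prime] {V W : Type*}
    [CommGroup V] [CommGroup W] (hV : ∀ v : V, v ^ p = 1) (hW : ∀ w : W, w ^ p = 1)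
    (f : V →* W) (hf : Function.Injective f) : ∃ g : W →* V, ∀ v, g (f v) = v := by
  let _ : Module (ZMod p) (Additive V) :=
    AddCommGroup.zmodModule fun x => congrArg Additive.ofMul (hV x.toMul)
  let _ : Module (ZMod p) (Additive W) :=
    AddCommGroup.zmodModule fun x => congrArg Additive.ofMul (hW x.toMul)
  obtain ⟨g, hg⟩ := LinearMap.exists_leftInverse_of_injective
    (AddMonoidHom.toZModLinearMap p (MonoidHom.toAdditive f)) (LinearMap.ker_eq_bot.2 hf)
  refine ⟨MonoidHom.toAdditive.symm g.toAddMonoidHom, fun v => ?_⟩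
  exact congrArg Additive.toMul (LinearMap.congr_fun hg (Additive.ofMul v))

namespace IsPCentralFiltration

variable {p : ℕ} {A H : Type*} [Group A] [Group H] {F : ℕ → Subgroup A}

theorem quotient_comm (hF : IsPCentralFiltration p F) (j : ℕ) :
    haveI := hF.normal
    ∀ v w : F j ⧸ (F (j + 1)).subgroupOf (F j), v * w = w * v := by
  have := hF.normal
  intro v w
  obtain ⟨x, rfl⟩ := QuotientGroup.mk_surjective v
  obtain ⟨y, rfl⟩ := QuotientGroup.mk_surjective w
  rw [← QuotientGroup.mk_mul, ← QuotientGroup.mk_mul, QuotientGroup.eq,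
    Subgroup.mem_subgroupOf]
  have := hF.comm j _ y.2 (x.1⁻¹)
  have h2 := (hF.normal (j + 1)).conj_mem _ this y.1⁻¹
  simpa [mul_assoc] using h2

theorem quotient_pow (hF : IsPCentralFiltration p F) (j : ℕ) :
    haveI := hF.normal
    ∀ v : F j ⧸ (F (j + 1)).subgroupOf (F j), v ^ p = 1 := by
  have := hF.normal
  intro v
  obtain ⟨x, rfl⟩ := QuotientGroup.mk_surjective v
  rw [← QuotientGroup.mk_pow, QuotientGroup.eq_one_iff, Subgroup.mem_subgroupOf]
  exact hF.pow j _ x.2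

/-- The inclusion of the graded pieces of the induced filtration of a subgroup splits. -/
theorem exists_graded_retraction [Fact p.Prime] (hF : IsPCentralFiltration p F) (φ : H →* A)
    (j : ℕ) :
    haveI := (hF.comap φ).normal
    ∃ l : A → H, (∀ u ∈ F j, φ (l u) ∈ F j) ∧ (∀ u ∈ F (j + 1), φ (l u) ∈ F (j + 1)) ∧
      (∀ u ∈ F j, ∀ v ∈ F j, (l (u * v) : H ⧸ (F (j + 1)).comap φ) = l u * l v) ∧
      (∀ h, φ h ∈ F j → (l (φ h) : H ⧸ (F (j + 1)).comap φ) = h) := by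
  have := hF.normal
  have := (hF.comap φ).normal
  let _ : CommGroup (F j ⧸ (F (j + 1)).subgroupOf (F j)) :=
    { (inferInstance : Group (F j ⧸ (F (j + 1)).subgroupOf (F j))) with
      mul_comm := hF.quotient_comm j }
  let _ : CommGroup ((F j).comap φ ⧸ ((F (j + 1)).comap φ).subgroupOf ((F j).comap φ)) :=
    { (inferInstance : Group ((F j).comap φ ⧸ ((F (j + 1)).comap φ).subgroupOf ((F j).comap φ)))
        with
      mul_comm := (hF.comap φ).quotient_comm j }
  let f : ((F j).comap φ ⧸ ((F (j + 1)).comap φ).subgroupOf ((F j).comap φ)) →*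
      (F j ⧸ (F (j + 1)).subgroupOf (F j)) :=
    QuotientGroup.map _ _ (φ.subgroupComap (F j)) fun x hx => hx
  have hf : Function.Injective f := by
    rw [injective_iff_map_eq_one]
    intro v hv
    obtain ⟨x, rfl⟩ := QuotientGroup.mk_surjective v
    rw [QuotientGroup.eq_one_iff]
    exact (QuotientGroup.eq_one_iff (N := (F (j + 1)).subgroupOf (F j)) _).1 hv
  obtain ⟨g, hg⟩ := MonoidHom.exists_retraction_of_exponent ((hF.comap φ).quotient_pow j)
    (hF.quotient_pow j) f hf
  let l : A → H := fun u => by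
    classical exact if hu : u ∈ F j then (g (QuotientGroup.mk ⟨u, hu⟩)).out.1 else 1
  have hl : ∀ u (hu : u ∈ F j), l u = (g (QuotientGroup.mk ⟨u, hu⟩)).out.1 := fun u hu =>
    dif_pos hu
  have hmem : ∀ u ∈ F j, φ (l u) ∈ F j := fun u hu => by
    rw [hl u hu]; exact (g (QuotientGroup.mk ⟨u, hu⟩)).out.2
  have hmk : ∀ u (hu : u ∈ F j),
      (QuotientGroup.mk ⟨l u, hmem u hu⟩ :
        (F j).comap φ ⧸ ((F (j + 1)).comap φ).subgroupOf ((F j).comap φ)) =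
      g (QuotientGroup.mk ⟨u, hu⟩) := by
    intro u hu
    rw [← QuotientGroup.out_eq' (g (QuotientGroup.mk ⟨u, hu⟩))]
    congr 1
    exact Subtype.ext (hl u hu)
  refine ⟨l, hmem, fun u hu => ?_, fun u hu v hv => ?_, fun h hh => ?_⟩
  · have h1 := hmk u (hF.anti j.le_succ hu)
    rw [(QuotientGroup.eq_one_iff (N := (F (j + 1)).subgroupOf (F j)) _).2 hu, map_one,
      QuotientGroup.eq_one_iff] at h1
    exact h1
  · have h1 := hmk _ ((F j).mul_mem hu hv)
    have h2 : (QuotientGroup.mk ⟨u * v, (F j).mul_mem hu hv⟩ :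
        F j ⧸ (F (j + 1)).subgroupOf (F j)) =
        QuotientGroup.mk ⟨u, hu⟩ * QuotientGroup.mk ⟨v, hv⟩ := rfl
    rw [h2, map_mul, ← hmk u hu, ← hmk v hv, ← QuotientGroup.mk_mul, QuotientGroup.eq] at h1
    rw [← QuotientGroup.mk_mul, QuotientGroup.eq]
    exact h1
  · have h1 := hmk _ hh
    have h2 := hg (QuotientGroup.mk ⟨h, hh⟩)
    have h3 : f (QuotientGroup.mk ⟨h, hh⟩) = QuotientGroup.mk ⟨φ h, hh⟩ := rfl
    rw [h3, ← h1, QuotientGroup.eq] at h2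
    exact QuotientGroup.eq.2 h2

end IsPCentralFiltration

end Filtrations

/-! ### Equivariant retractions onto a subgroup. -/

section Retraction

namespace IsPCentralFiltration

variable {p : ℕ} {A H : Type*} [Group A] [Group H] {F : ℕ → Subgroup A}

/-- A filtered group retracts onto a subgroup by an equivariant map that induces
translation-invariant maps on the graded pieces. -/
theorem exists_equivariant_retraction [Fact p.Prime] (hF : IsPCentralFiltration p F)
    (φ : H →* A) (m : ℕ) :
    haveI := (hF.comap φ).normal
    ∃ π : A → H, (∀ h a, (π (φ h * a) : H ⧸ (F m).comap φ) = h * π a) ∧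
      (∀ u ∈ F m, ∀ a, (π (a * u) : H ⧸ (F m).comap φ) = π a) ∧
      ∀ j < m, ∀ u ∈ F j, ∃ c : H ⧸ (F (j + 1)).comap φ, ∀ a,
        (π (a * u) : H ⧸ (F (j + 1)).comap φ) = π a * c := by
  have hK := hF.comap φ
  have := hF.normal
  have := hK.normal
  induction m with
  | zero =>
    refine ⟨fun _ => 1, fun h a => QuotientGroup.eq.2 ?_, fun u _ a => rfl,
      fun j hj => absurd hj j.not_lt_zero⟩
    rw [hK.zero]
    trivial
  | succ m ih =>
    obtain ⟨π, hπ, hinv, hc⟩ := ih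
    obtain ⟨l, hlm, hls, hlmul, hlφ⟩ := hF.exists_graded_retraction φ m
    have hone : ∀ {i} {h : H}, φ h ∈ F i → (h : H ⧸ (F i).comap φ) = 1 := fun h =>
      (QuotientGroup.eq_one_iff _).2 h
    -- The next map sends `φ h * r * u` to `h * π r * l u`; this is its well-definedness. Two
    -- expressions differ by an element of `φ H` conjugate under `r` to `u₂ * u₁⁻¹`. Layer `m` is
    -- central modulo `F (m + 1)`, so the conjugation is invisible and `l` recovers that element.
    have key : ∀ r h₁ h₂ u₁ u₂, u₁ ∈ F m → u₂ ∈ F m → φ h₁ * r * u₁ = φ h₂ * r * u₂ →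
        ((h₁ * π r * l u₁ : H) : H ⧸ (F (m + 1)).comap φ) = (h₂ * π r * l u₂ : H) := by
      intro r h₁ h₂ u₁ u₂ hu₁ hu₂ h
      have hu : u₂ * u₁⁻¹ ∈ F m := (F m).mul_mem hu₂ ((F m).inv_mem hu₁)
      have hk : φ (h₂⁻¹ * h₁) = r * (u₂ * u₁⁻¹) * r⁻¹ := by
        have h' : φ h₁ = φ h₂ * r * u₂ * u₁⁻¹ * r⁻¹ := by
          rw [← h]
          group
        rw [map_mul, map_inv, h']
        group
      have hkm : φ (h₂⁻¹ * h₁) ∈ F m := by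
        rw [hk]
        exact (hF.normal m).conj_mem _ hu r
      have hw : φ (h₂⁻¹ * h₁) * (u₂ * u₁⁻¹)⁻¹ ∈ F (m + 1) := by
        rw [hk]
        exact hF.comm m _ hu r
      have h1 : (l (φ (h₂⁻¹ * h₁) * (u₂ * u₁⁻¹)⁻¹ * u₂) : H ⧸ (F (m + 1)).comap φ) = l u₂ := by
        rw [hlmul _ (hF.anti m.le_succ hw) _ hu₂, hone (hls _ hw), one_mul]
      have h2 : φ (h₂⁻¹ * h₁) * (u₂ * u₁⁻¹)⁻¹ * u₂ = φ (h₂⁻¹ * h₁) * u₁ := by group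
      rw [h2, hlmul _ hkm _ hu₁, hlφ _ hkm] at h1
      rw [show h₁ * π r * l u₁ = h₂ * ((h₂⁻¹ * h₁) * π r) * l u₁ by group]
      have h3 := hK.mk_comm (j := m) (x := h₂⁻¹ * h₁) hkm (π r)
      rw [QuotientGroup.mk_mul, QuotientGroup.mk_mul, QuotientGroup.mk_mul, ← h3,
        QuotientGroup.mk_mul, QuotientGroup.mk_mul, ← h1]
      simp only [QuotientGroup.mk_mul, mul_assoc]
    -- The classes are the double cosets of `φ H` and `F m`; one representative of each is fixed.
    let s : Setoid A :=
      { r := fun a b => ∃ h, ∃ u ∈ F m, φ h * a * u = b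
        iseqv :=
          { refl := fun a => ⟨1, 1, (F m).one_mem, by simp⟩
            symm := by
              rintro a _ ⟨h, u, hu, rfl⟩
              exact ⟨h⁻¹, u⁻¹, (F m).inv_mem hu, by simp [mul_assoc]⟩
            trans := by
              rintro a _ _ ⟨h, u, hu, rfl⟩ ⟨h', u', hu', rfl⟩
              exact ⟨h' * h, u * u', (F m).mul_mem hu hu', by simp [mul_assoc]⟩ } }
    have hr : ∀ a : A, ∃ h, ∃ u ∈ F m, φ h * (Quotient.mk s a).out * u = a := fun a =>
      Quotient.mk_out (s := s) a
    choose η υ hυ hηυ using hr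
    have hrc : ∀ h a u, u ∈ F m →
        (Quotient.mk s (φ h * a * u)).out = (Quotient.mk s a).out := fun h a u hu =>
      congrArg Quotient.out (Quotient.sound (s := s)
        (Setoid.symm (⟨h, u, hu, rfl⟩ : s.r a (φ h * a * u))))
    let π' : A → H := fun a => η a * π (Quotient.mk s a).out * l (υ a)
    have hπ' : ∀ h a u, u ∈ F m → (π' (φ h * a * u) : H ⧸ (F (m + 1)).comap φ) =
        h * π' a * l u := by
      intro h a u hu
      have h1 := key _ (η (φ h * a * u)) (h * η a) (υ (φ h * a * u)) (υ a * u) (hυ _)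
        ((F m).mul_mem (hυ _) hu)
        ((hηυ (φ h * a * u)).trans (by
          rw [hrc h a u hu]
          conv_lhs => rw [← hηυ a]
          simp only [map_mul, mul_assoc]))
      refine h1.trans ?_
      rw [QuotientGroup.mk_mul, hlmul _ (hυ a) _ hu, hrc h a u hu]
      simp only [π', QuotientGroup.mk_mul, mul_assoc]
    -- The new map refines the old one, so the constants `c` of the layers below `m` survive.
    have hππ' : ∀ a, (π' a : H ⧸ (F m).comap φ) = π a := by
      intro a
      conv_rhs => rw [← hηυ a]
      rw [hinv _ (hυ a), hπ]
      simp only [π', QuotientGroup.mk_mul]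
      rw [hone (hlm _ (hυ a)), mul_one]
    refine ⟨π', fun h a => ?_, fun u hu a => ?_, fun j hj u hu => ?_⟩
    · have h1 := hπ' h a 1 (F m).one_mem
      have h2 := hlmul 1 (F m).one_mem 1 (F m).one_mem
      rw [mul_one, left_eq_mul] at h2
      rwa [mul_one, h2, mul_one] at h1
    · have h1 := hπ' 1 a u (hF.anti m.le_succ hu)
      rwa [map_one, one_mul, QuotientGroup.mk_one, one_mul, hone (hls _ hu), mul_one] at h1
    · rcases (Nat.lt_succ_iff_lt_or_eq.1 hj) with hj | rfl
      · obtain ⟨c, hc⟩ := hc j hj u hu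
        refine ⟨c, fun a => ?_⟩
        rw [hK.mk_eq_of_le hj (hππ' a), hK.mk_eq_of_le hj (hππ' (a * u)), hc]
      · refine ⟨l u, fun a => ?_⟩
        have h1 := hπ' 1 a u hu
        rwa [map_one, one_mul, QuotientGroup.mk_one, one_mul] at h1

end IsPCentralFiltration

end Retraction

/-! ### Triangular permutations. -/

section Triangular

variable {p : ℕ} {W X : Type*} [Group W] {F : ℕ → Subgroup W}

theorem IsPCentralFiltration.mem_of_mk_eq (hF : IsPCentralFiltration p F) {j : ℕ} {x y : W}
    (h : (x : W ⧸ F (j + 1)) = y) (hx : x ∈ F j) : y ∈ F j := by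
  have := (F j).mul_mem hx (hF.anti j.le_succ (QuotientGroup.eq.1 h))
  rwa [mul_inv_cancel_left] at this

/-- Permutations of a subset of a filtered group that act on each layer by translations. -/
def triangularPerm (hF : IsPCentralFiltration p F) (m : ℕ) (ι : X → W) :
    Subgroup (Equiv.Perm X) where
  carrier := {q | ∀ j < m, ∀ x y, (ι x)⁻¹ * ι y ∈ F j →
    (((ι x)⁻¹ * ι y : W) : W ⧸ F (j + 1)) = ((ι (q x))⁻¹ * ι (q y) : W)}
  one_mem' _ _ _ _ _ := rfl
  mul_mem' := by
    intro q r hq hr j hj x y h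
    have h1 := hr j hj x y h
    exact h1.trans (hq j hj _ _ (hF.mem_of_mk_eq h1 h))
  inv_mem' := by
    intro q hq j hj x y h
    have hqq : ∀ z, q (q⁻¹ z) = z := q.apply_symm_apply
    -- A triangular `q` preserves differences one layer at a time, so membership for the preimages
    -- is climbed to from `F 0 = ⊤`.
    have key : ∀ i ≤ j, (ι (q⁻¹ x))⁻¹ * ι (q⁻¹ y) ∈ F i := by
      intro i
      induction i with
      | zero =>
        intro _
        rw [hF.zero]
        trivial
      | succ i ih =>
        intro hi
        have h1 := hq i (by omega) _ _ (ih (by omega))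
        rw [hqq, hqq] at h1
        have h2 := (F (i + 1)).mul_mem (hF.anti hi h) (QuotientGroup.eq.1 h1.symm)
        rwa [mul_inv_cancel_left] at h2
    have h1 := hq j hj _ _ (key j le_rfl)
    rw [hqq, hqq] at h1
    exact h1.symm

/-- If `q` displaces every point by an element of `F j`, triangularity makes the displacement of `q
^ r` the `r`-th power of that of `q` modulo `F (j + 1)`. Hence `q ^ p` displaces by elements of `F
(j + 1)`, and `q ^ p ^ m` fixes every point. -/
theorem isPGroup_triangularPerm (hF : IsPCentralFiltration p F) {m : ℕ} (hm : F m = ⊥)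
    {ι : X → W} (hι : Function.Injective ι) : IsPGroup p (triangularPerm hF m ι) := by
  have := hF.normal
  have step : ∀ q ∈ triangularPerm hF m ι, ∀ j < m, (∀ x, (ι x)⁻¹ * ι (q x) ∈ F j) →
      ∀ x, (ι x)⁻¹ * ι ((q ^ p) x) ∈ F (j + 1) := by
    intro q hq j hj h x
    have hr : ∀ r : ℕ, (ι x)⁻¹ * ι ((q ^ r) x) ∈ F j ∧
        (((ι x)⁻¹ * ι ((q ^ r) x) : W) : W ⧸ F (j + 1)) = (((ι x)⁻¹ * ι (q x)) ^ r : W) := by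
      intro r
      induction r with
      | zero => simp [(F j).one_mem]
      | succ r ih =>
        have h1 := hq j hj x _ ih.1
        have h2 : (ι x)⁻¹ * ι ((q ^ (r + 1)) x) =
            ((ι x)⁻¹ * ι (q x)) * ((ι (q x))⁻¹ * ι (q ((q ^ r) x))) := by
          rw [pow_succ', Equiv.Perm.mul_apply]
          group
        refine ⟨?_, ?_⟩
        · rw [h2]
          exact (F j).mul_mem (h x) (hF.mem_of_mk_eq h1 ih.1)
        · rw [h2, QuotientGroup.mk_mul, ← h1, ih.2, ← QuotientGroup.mk_mul, ← pow_succ']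
    rw [← QuotientGroup.eq_one_iff, (hr p).2, QuotientGroup.eq_one_iff]
    exact hF.pow j _ (h x)
  intro q
  have hq : ∀ j ≤ m, ∀ x, (ι x)⁻¹ * ι ((q.1 ^ p ^ j) x) ∈ F j := by
    intro j
    induction j with
    | zero =>
      intro _ x
      rw [hF.zero]
      trivial
    | succ j ih =>
      intro hj x
      have := step _ (Subgroup.pow_mem _ q.2 (p ^ j)) j hj (ih (by omega)) x
      rwa [← pow_mul, ← pow_succ] at this
  refine ⟨m, Subtype.ext (Equiv.ext fun x => hι ?_)⟩
  have := hq m le_rfl x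
  rw [hm, Subgroup.mem_bot, inv_mul_eq_one] at this
  exact this.symm

end Triangular

/-! ### Higman's amalgam of finite `p`-groups. -/

section Amalgam

variable {p : ℕ} {A B H : Type*} [Group A] [Group B] [Group H]

/-- The left translation action of `A` on the fibre product `A ×_H B` of two groups over
maps to a common subgroup `H`, for maps that are equivariant under `H`. -/
def fiberProductPerm (f : H →* B) (π : A → H) (ρ : B → H) (hρ : ∀ h b, ρ (f h * b) = h * ρ b) :
    A →* Equiv.Perm {x : A × B // π x.1 = ρ x.2} :=
  letI : MulAction A {x : A × B // π x.1 = ρ x.2} :=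
    { smul := fun a x => ⟨(a * x.1.1, f (π (a * x.1.1) * (π x.1.1)⁻¹) * x.1.2), by
        rw [hρ, ← x.2, inv_mul_cancel_right]⟩
      one_smul := fun x => Subtype.ext (Prod.ext (one_mul _) (by
        change f (π (1 * x.1.1) * (π x.1.1)⁻¹) * x.1.2 = _
        simp))
      mul_smul := fun a b x => Subtype.ext (Prod.ext (mul_assoc _ _ _) (by
        change f (π (a * b * x.1.1) * (π x.1.1)⁻¹) * x.1.2 =
          f (π (a * (b * x.1.1)) * (π (b * x.1.1))⁻¹) * (f (π (b * x.1.1) * (π x.1.1)⁻¹) * x.1.2)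
        simp [mul_assoc])) }
  MulAction.toPermHom A _

theorem fiberProductPerm_apply (f : H →* B) (π : A → H) (ρ : B → H)
    (hρ : ∀ h b, ρ (f h * b) = h * ρ b) (a : A) (x : {x : A × B // π x.1 = ρ x.2}) :
    (fiberProductPerm f π ρ hρ a x).1 =
      (a * x.1.1, f (π (a * x.1.1) * (π x.1.1)⁻¹) * x.1.2) :=
  rfl

variable {F : ℕ → Subgroup A} {E : ℕ → Subgroup B}

/-- The source of triangularity. Left translation preserves differences of first coordinates
exactly. The second coordinate is multiplied by `f (π (a * x) * (π x)⁻¹)`; replacing `x` by `x * u`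
multiplies both values of `π` on the right by the same `c`, which cancels. -/
theorem fiberProductPerm_congr (hF : IsPCentralFiltration p F) (hE : IsPCentralFiltration p E)
    (φ : H →* A) (f : H →* B) (hφf : ∀ j, (F j).comap φ = (E j).comap f) {m : ℕ} (π : A → H)
    (hπ : haveI := (hF.comap φ).normal
      ∀ j < m, ∀ u ∈ F j, ∃ c : H ⧸ (F (j + 1)).comap φ, ∀ a,
        (π (a * u) : H ⧸ (F (j + 1)).comap φ) = π a * c)
    (ρ : B → H) (hρ : ∀ h b, ρ (f h * b) = h * ρ b) (a : A) (j : ℕ) (hj : j < m)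
    (x y : {x : A × B // π x.1 = ρ x.2}) (h₁ : x.1.1⁻¹ * y.1.1 ∈ F j) :
    (((fiberProductPerm f π ρ hρ a x).1.1)⁻¹ * (fiberProductPerm f π ρ hρ a y).1.1 =
      x.1.1⁻¹ * y.1.1) ∧
    (((x.1.2⁻¹ * y.1.2 : B) : B ⧸ E (j + 1)) =
      (((fiberProductPerm f π ρ hρ a x).1.2)⁻¹ * (fiberProductPerm f π ρ hρ a y).1.2 : B)) := by
  have := (hF.comap φ).normal
  have := hE.normal
  simp only [fiberProductPerm_apply]
  refine ⟨by group, ?_⟩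
  obtain ⟨c, hc⟩ := hπ j hj _ h₁
  have h1 := hc x.1.1
  have h2 := hc (a * x.1.1)
  rw [mul_assoc] at h2
  rw [mul_inv_cancel_left] at h1 h2
  have h3 : ((π (a * x.1.1) * (π x.1.1)⁻¹ : H) : H ⧸ (F (j + 1)).comap φ) =
      (π (a * y.1.1) * (π y.1.1)⁻¹ : H) := by
    rw [QuotientGroup.mk_mul, QuotientGroup.mk_mul, QuotientGroup.mk_inv, QuotientGroup.mk_inv,
      h1, h2]
    group
  rw [QuotientGroup.eq, hφf, Subgroup.mem_comap, map_mul, map_inv, ← QuotientGroup.eq] at h3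
  simp only [QuotientGroup.mk_mul, QuotientGroup.mk_inv, h3]
  group

/-- Higman's theorem on amalgams of `p`-groups: two groups with finite `p`-central filtrations
that induce the same filtration on a common subgroup embed compatibly into a `p`-group. -/
theorem exists_isPGroup_amalgam [Fact p.Prime] {A B H : Type u} [Group A] [Group B] [Group H]
    [Finite A] [Finite B] {F : ℕ → Subgroup A} {E : ℕ → Subgroup B}
    (hF : IsPCentralFiltration p F) (hE : IsPCentralFiltration p E)
    (φ : H →* A) (f : H →* B) (hφ : Function.Injective φ)
    (hφf : ∀ j, (F j).comap φ = (E j).comap f) {m : ℕ} (hFm : F m = ⊥) (hEm : E m = ⊥) :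
    ∃ (Q : Type u) (_ : Group Q) (_ : Finite Q), IsPGroup p Q ∧ ∃ (α : A →* Q) (β : B →* Q),
      Function.Injective α ∧ Function.Injective β ∧ α.comp φ = β.comp f := by
  have := (hF.comap φ).normal
  have := (hE.comap f).normal
  -- Level `m` is trivial on `H`, so equivariance modulo level `m` is exact.
  have hbot : (F m).comap φ = ⊥ := by
    rw [hFm, MonoidHom.comap_bot, (MonoidHom.ker_eq_bot_iff φ).2 hφ]
  obtain ⟨π, hπ, -, hπc⟩ := hF.exists_equivariant_retraction φ m
  obtain ⟨ρ, hρ, -, hρc⟩ := hE.exists_equivariant_retraction f m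
  have hπ' : ∀ h a, π (φ h * a) = h * π a := by
    intro h a
    have := hπ h a
    rw [← QuotientGroup.mk_mul, QuotientGroup.eq, hbot, Subgroup.mem_bot, inv_mul_eq_one] at this
    exact this
  have hρ' : ∀ h b, ρ (f h * b) = h * ρ b := by
    intro h b
    have := hρ h b
    rw [← QuotientGroup.mk_mul, QuotientGroup.eq, ← hφf, hbot, Subgroup.mem_bot,
      inv_mul_eq_one] at this
    exact this
  let X := {x : A × B // π x.1 = ρ x.2}
  let Y := {y : B × A // ρ y.1 = π y.2}
  let e : Y ≃ X :=
    { toFun := fun y => ⟨y.1.swap, y.2.symm⟩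
      invFun := fun x => ⟨x.1.swap, x.2.symm⟩
      left_inv := fun _ => rfl
      right_inv := fun _ => rfl }
  let T := triangularPerm (hF.prod hE) m (Subtype.val : X → A × B)
  have := hF.normal
  have := hE.normal
  have hα : ∀ a, fiberProductPerm f π ρ hρ' a ∈ T := by
    intro a j hj x y hxy
    obtain ⟨h1, h2⟩ := fiberProductPerm_congr hF hE φ f hφf π hπc ρ hρ' a j hj x y hxy.1
    rw [QuotientGroup.eq] at h2 ⊢
    refine ⟨?_, h2⟩
    change (x.1.1⁻¹ * y.1.1)⁻¹ * (((fiberProductPerm f π ρ hρ' a x).1.1)⁻¹ *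
      (fiberProductPerm f π ρ hρ' a y).1.1) ∈ F (j + 1)
    rw [h1, inv_mul_cancel]
    exact (F (j + 1)).one_mem
  have hβ : ∀ b, e.permCongrHom (fiberProductPerm φ ρ π hπ' b) ∈ T := by
    intro b j hj x y hxy
    obtain ⟨h1, h2⟩ := fiberProductPerm_congr hE hF f φ (fun j => (hφf j).symm) ρ hρc π hπ' b j hj
      (e.symm x) (e.symm y) hxy.2
    rw [QuotientGroup.eq] at h2 ⊢
    refine ⟨h2, ?_⟩
    change (x.1.2⁻¹ * y.1.2)⁻¹ * (((fiberProductPerm φ ρ π hπ' b (e.symm x)).1.1)⁻¹ *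
      (fiberProductPerm φ ρ π hπ' b (e.symm y)).1.1) ∈ E (j + 1)
    rw [h1]
    change (x.1.2⁻¹ * y.1.2)⁻¹ * (x.1.2⁻¹ * y.1.2) ∈ E (j + 1)
    rw [inv_mul_cancel]
    exact (E (j + 1)).one_mem
  -- One point suffices for faithfulness: `A` and `B` act on their own coordinate by left
  -- translation. The second coordinate is chosen so that `ρ` takes the value `π 1` there.
  let x₀ : X := ⟨(1, f (π 1 * (ρ 1)⁻¹) * 1), by rw [hρ', inv_mul_cancel_right]⟩
  refine ⟨T, inferInstance, inferInstance,
    isPGroup_triangularPerm (hF.prod hE) ?_ Subtype.val_injective,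
    (fiberProductPerm f π ρ hρ').codRestrict T hα,
    (e.permCongrHom.toMonoidHom.comp (fiberProductPerm φ ρ π hπ')).codRestrict T hβ,
    ?_, ?_, ?_⟩
  · rw [hFm, hEm, Subgroup.bot_prod_bot]
  · intro a a' h
    exact mul_right_cancel (congrArg (fun q : T => (q.1 x₀).1.1) h)
  · intro b b' h
    exact mul_right_cancel (congrArg (fun q : T => (q.1 x₀).1.2) h)
  -- By equivariance the correcting factor of an element `h` of `H` is `h` itself, so both actions
  -- translate both coordinates by `h`.
  · refine MonoidHom.ext fun h => Subtype.ext (Equiv.ext fun x => Subtype.ext ?_)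
    change (fiberProductPerm f π ρ hρ' (φ h) x).1 =
      (fiberProductPerm φ ρ π hπ' (f h) (e.symm x)).1.swap
    have h1 : (e.symm x).1 = x.1.swap := rfl
    rw [fiberProductPerm_apply, fiberProductPerm_apply, h1]
    simp [hπ', hρ']

end Amalgam

/-! ### The lower `p`-central series as a filtration by open subgroups. -/

section LowerPCentral

open scoped commutatorElement

/-- Hall's collection formula in class two. For odd `p` the exponent `p.choose 2` is divisible by
`p`, so the error disappears when `z` has order dividing `p`. -/
theorem mul_pow_of_commutator_central {G : Type*} [Group G] {x y z : G} (h : y * x = x * y * z)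
    (hx : Commute z x) (hy : Commute z y) (n : ℕ) :
    (x * y) ^ n = x ^ n * y ^ n * z ^ n.choose 2 := by
  have h1 : ∀ n : ℕ, y ^ n * x = x * y ^ n * z ^ n := by
    intro n
    induction n with
    | zero => simp
    | succ n ih =>
      rw [pow_succ', mul_assoc, ih, ← mul_assoc, ← mul_assoc, h, pow_succ' z]
      simp only [mul_assoc]
      rw [← mul_assoc z (y ^ n), (hy.pow_right n).eq]
      simp only [mul_assoc]
  induction n with
  | zero => simp
  | succ n ih =>
    rw [pow_succ, ih, show (n + 1).choose 2 = n + n.choose 2 by simp [Nat.choose_succ_succ'], pow_add z,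
      mul_assoc (x ^ n * y ^ n), ((hx.mul_right hy).pow_left (n.choose 2)).eq,
      ← mul_assoc, ← mul_assoc, mul_assoc (x ^ n), h1, pow_succ x n, pow_succ y n]
    simp only [mul_assoc]
    rw [← mul_assoc (z ^ n) y, (hy.pow_left n).eq]
    simp only [mul_assoc]

variable {p : ℕ} {G : Type*} [Group G] [TopologicalSpace G] [IsTopologicalGroup G]

theorem closedSpan_le {S : Set G} {K : Subgroup G} (hK : IsClosed (K : Set G)) (h : S ⊆ K) :
    closedSpan S ≤ K :=
  Subgroup.topologicalClosure_minimal _ ((Subgroup.closure_le K).2 h) hK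

theorem subset_closedSpan (S : Set G) : S ⊆ closedSpan S :=
  Subgroup.subset_closure.trans (Subgroup.le_topologicalClosure _)

theorem isClosed_lowerPCentral (i : ℕ) : IsClosed (lowerPCentral p G i : Set G) := by
  cases i with
  | zero => exact isClosed_univ
  | succ i => exact Subgroup.isClosed_topologicalClosure _

theorem lowerPCentral_succ_le {i : ℕ} {K : Subgroup G} (hK : IsClosed (K : Set G))
    (hpow : ∀ x ∈ lowerPCentral p G i, x ^ p ∈ K)
    (hcomm : ∀ x ∈ lowerPCentral p G i, ∀ g, g * x * g⁻¹ * x⁻¹ ∈ K) :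
    lowerPCentral p G (i + 1) ≤ K := by
  refine Subgroup.topologicalClosure_minimal _ (sup_le (closedSpan_le hK ?_) ?_) hK
  · rintro _ ⟨x, hx, rfl⟩
    exact hpow x hx
  · refine Subgroup.topologicalClosure_minimal _ (Subgroup.commutator_le.2 fun x hx g _ => ?_) hK
    rw [← commutatorElement_inv]
    exact K.inv_mem (hcomm x hx g)

theorem pow_mem_lowerPCentral_succ {i : ℕ} {x : G} (hx : x ∈ lowerPCentral p G i) :
    x ^ p ∈ lowerPCentral p G (i + 1) :=
  Subgroup.le_topologicalClosure _ (Subgroup.mem_sup_left (subset_closedSpan _ ⟨x, hx, rfl⟩))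

theorem commutator_mem_lowerPCentral_succ {i : ℕ} {x : G} (hx : x ∈ lowerPCentral p G i) (g : G) :
    g * x * g⁻¹ * x⁻¹ ∈ lowerPCentral p G (i + 1) := by
  have : ⁅x, g⁆ ∈ ⁅lowerPCentral p G i, ⊤⁆ :=
    Subgroup.commutator_mem_commutator hx (Subgroup.mem_top g)
  have := Subgroup.inv_mem _ this
  rw [commutatorElement_inv] at this
  exact Subgroup.le_topologicalClosure _
    (Subgroup.mem_sup_right (Subgroup.le_topologicalClosure _ this))

theorem isPCentralFiltration_lowerPCentral : IsPCentralFiltration p (lowerPCentral p G) := by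
  have hle : ∀ i, lowerPCentral p G (i + 1) ≤ lowerPCentral p G i := by
    -- Proved jointly: descent at `i` needs normality of `P i`, and normality of `P (i + 1)` needs
    -- descent at `i`.
    have key : ∀ i, (lowerPCentral p G i).Normal ∧
        lowerPCentral p G (i + 1) ≤ lowerPCentral p G i := by
      have hsucc : ∀ i, (lowerPCentral p G i).Normal →
          lowerPCentral p G (i + 1) ≤ lowerPCentral p G i := fun i h =>
        lowerPCentral_succ_le (isClosed_lowerPCentral i) (fun x hx => Subgroup.pow_mem _ hx p)
          fun x hx g => Subgroup.mul_mem _ (h.conj_mem x hx g) (Subgroup.inv_mem _ hx)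
      intro i
      induction i with
      | zero => exact ⟨Subgroup.normal_top, hsucc 0 Subgroup.normal_top⟩
      | succ i ih =>
        have hn : (lowerPCentral p G (i + 1)).Normal :=
          { conj_mem := fun x hx g => by
              have := Subgroup.mul_mem _ (commutator_mem_lowerPCentral_succ (ih.2 hx) g) hx
              rwa [inv_mul_cancel_right] at this }
        exact ⟨hn, hsucc _ hn⟩
    exact fun i => (key i).2
  exact
    { zero := rfl
      anti := antitone_nat_of_succ_le hle
      comm := fun j x hx g => commutator_mem_lowerPCentral_succ hx g
      pow := fun j x hx => pow_mem_lowerPCentral_succ hx }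

instance normal_lowerPCentral (i : ℕ) : (lowerPCentral p G i).Normal :=
  isPCentralFiltration_lowerPCentral.normal i

/-- The quotient by `P 1` is abelian of exponent `p`, so the generators have a finite span `L`
there. As `P 1` is closed, finite sets in the quotient are closed; the preimage of `L` is then a
closed subgroup containing the generators. -/
theorem finiteIndex_lowerPCentral_one [hp : Fact p.Prime]
    (hfg : ∃ S : Finset G, closedSpan (S : Set G) = ⊤) :
    (lowerPCentral p G 1).FiniteIndex := by
  obtain ⟨S, hS⟩ := hfg
  have hF := isPCentralFiltration_lowerPCentral (p := p) (G := G)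
  let V := G ⧸ lowerPCentral p G 1
  let _ : CommGroup V :=
    { (inferInstance : Group V) with
      mul_comm := by
        intro a b
        obtain ⟨a, rfl⟩ := QuotientGroup.mk_surjective a
        obtain ⟨b, rfl⟩ := QuotientGroup.mk_surjective b
        exact (hF.mk_comm (j := 0) (Subgroup.mem_top a) b).symm }
  let L : Subgroup V := Subgroup.closure ((QuotientGroup.mk : G → V) '' S)
  have hL : Finite L := by
    have hfg : Group.FG L := (Group.fg_iff_subgroup_fg L).2
      ⟨(S.finite_toSet.image (QuotientGroup.mk : G → V)).toFinset, by simp [L]⟩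
    have htors : IsMulTorsion L := by
      intro x
      obtain ⟨g, hg⟩ := QuotientGroup.mk_surjective x.1
      refine isOfFinOrder_iff_pow_eq_one.2 ⟨p, hp.out.pos, Subtype.ext ?_⟩
      change x.1 ^ p = 1
      rw [← hg, ← QuotientGroup.mk_pow, QuotientGroup.eq_one_iff]
      exact hF.pow 0 g (Subgroup.mem_top g)
    exact CommGroup.finite_of_fg_isMulTorsion L htors
  have hcl : IsClosed (lowerPCentral p G 1 : Set G) := isClosed_lowerPCentral 1
  have hLcl : IsClosed ((L.comap (QuotientGroup.mk' (lowerPCentral p G 1)) : Subgroup G) : Set G) :=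
    (Set.toFinite (L : Set V)).isClosed.preimage QuotientGroup.continuous_mk
  have htop : L.comap (QuotientGroup.mk' (lowerPCentral p G 1)) = ⊤ := by
    rw [eq_top_iff, ← hS]
    exact closedSpan_le hLcl fun x hx => Subgroup.subset_closure ⟨x, hx, rfl⟩
  have hLtop : L = ⊤ := by
    rw [eq_top_iff]
    intro x _
    obtain ⟨g, rfl⟩ := QuotientGroup.mk_surjective x
    exact htop.ge (Subgroup.mem_top g)
  rw [hLtop] at hL
  have : Finite V := Finite.of_equiv _ Subgroup.topEquiv.toEquiv
  exact Subgroup.finiteIndex_of_finite_quotient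

/-- All layers have the index of `P 1`, which is finite (index `0` stands for infinite); a closed
subgroup of finite index is open. -/
theorem IsUniformProPGroup.isOpen_lowerPCentral [Fact p.Prime] (hG : IsUniformProPGroup p G)
    (i : ℕ) : IsOpen (lowerPCentral p G i : Set G) := by
  have h1 : (lowerPCentral p G 1).index ≠ 0 :=
    (finiteIndex_lowerPCentral_one hG.finitelyGenerated).index_ne_zero
  have hi : (lowerPCentral p G i).index ≠ 0 := by
    induction i with
    | zero => exact (Subgroup.index_top (G := G)).trans_ne one_ne_zero
    | succ i ih =>
      rw [← Subgroup.relIndex_mul_index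
        (isPCentralFiltration_lowerPCentral.anti i.le_succ), hG.index_eq i]
      exact mul_ne_zero h1 ih
  have : (lowerPCentral p G i).FiniteIndex := ⟨hi⟩
  exact Subgroup.isOpen_of_isClosed_of_finiteIndex _ (isClosed_lowerPCentral i)

/-- Induction on the index: a nontrivial finite `p`-group has a central element `z` of order `p`. If
`P i` lies in the preimage of `⟨z⟩`, then `P (i + 1)` lies in `U`. -/
theorem exists_lowerPCentral_le [Fact p.Prime] [CompactSpace G]
    (hG : ∀ U : OpenNormalSubgroup G, IsPGroup p (G ⧸ U.toSubgroup)) (U : Subgroup G) [U.Normal]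
    (hU : IsOpen (U : Set G)) : ∃ i, lowerPCentral p G i ≤ U := by
  induction hn : U.index using Nat.strong_induction_on generalizing U with
  | _ n ih =>
  by_cases htop : U = ⊤
  · exact ⟨0, htop.ge⟩
  have hfin : Finite (G ⧸ U) := Subgroup.quotient_finite_of_isOpen U hU
  have hpU : IsPGroup p (G ⧸ U) := hG ⟨⟨U, hU⟩, inferInstance⟩
  have : Nontrivial (G ⧸ U) := QuotientGroup.nontrivial_iff.2 htop
  have hZ := hpU.center_nontrivial
  have hZp := hpU.to_subgroup (Subgroup.center (G ⧸ U))
  obtain ⟨k, hk, hkZ⟩ := (hZp.nontrivial_iff_card).1 hZ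
  obtain ⟨z, hz⟩ := exists_prime_orderOf_dvd_card' (G := Subgroup.center (G ⧸ U)) p
    (hkZ ▸ dvd_pow_self p hk.ne')
  have hzp : z ^ p = 1 := hz ▸ pow_orderOf_eq_one z
  have hz1 : z ≠ 1 := by
    rintro rfl
    rw [orderOf_one] at hz
    exact (Fact.out : p.Prime).one_lt.ne hz
  have hzc : ∀ w ∈ Subgroup.zpowers z.1, ∀ v, v * w = w * v := by
    rintro _ ⟨a, rfl⟩ v
    exact (Subgroup.mem_center_iff.1 ((Subgroup.center (G ⧸ U)).zpow_mem z.2 a)) v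
  have hnz : (Subgroup.zpowers z.1).Normal :=
    { conj_mem := fun w hw v => by rwa [hzc w hw v, mul_inv_cancel_right] }
  let U' : Subgroup G := (Subgroup.zpowers z.1).comap (QuotientGroup.mk' U)
  have hUU' : U < U' := by
    refine lt_of_le_of_ne (fun x hx => ?_) fun h => hz1 (Subtype.ext ?_)
    · change (x : G ⧸ U) ∈ Subgroup.zpowers z.1
      rw [(QuotientGroup.eq_one_iff x).2 hx]
      exact Subgroup.one_mem _
    · obtain ⟨g, hg⟩ := QuotientGroup.mk_surjective z.1
      have : g ∈ U' := by
        change (g : G ⧸ U) ∈ Subgroup.zpowers z.1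
        rw [hg]
        exact Subgroup.mem_zpowers _
      rw [← h] at this
      rw [← hg, (QuotientGroup.eq_one_iff g).2 this]
      rfl
  have : U.FiniteIndex := Subgroup.finiteIndex_of_finite_quotient
  obtain ⟨i, hi⟩ := ih U'.index (hn ▸ Subgroup.index_strictAnti hUU') U'
    (Subgroup.isOpen_mono hUU'.le hU) rfl
  refine ⟨i + 1, lowerPCentral_succ_le (Subgroup.isClosed_of_isOpen U hU) (fun x hx => ?_)
    fun x hx g => ?_⟩
  · rw [← QuotientGroup.eq_one_iff, QuotientGroup.mk_pow]
    obtain ⟨a, ha⟩ := hi hx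
    have hzp' : z.1 ^ p = 1 := congrArg Subtype.val hzp
    have ha' : z.1 ^ a = (x : G ⧸ U) := ha
    rw [← ha', ← zpow_natCast, zpow_comm, zpow_natCast, hzp', one_zpow]
  · rw [← QuotientGroup.eq_one_iff]
    simp only [QuotientGroup.mk_mul, QuotientGroup.mk_inv]
    rw [hzc (x : G ⧸ U) (hi hx), mul_inv_cancel_right, mul_inv_cancel]

theorem exists_lowerPCentral_subset [Fact p.Prime] [CompactSpace G] [TotallyDisconnectedSpace G]
    [T2Space G] (hG : ∀ U : OpenNormalSubgroup G, IsPGroup p (G ⧸ U.toSubgroup)) {V : Set G}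
    (hV : IsOpen V) (h1 : 1 ∈ V) : ∃ i, (lowerPCentral p G i : Set G) ⊆ V := by
  obtain ⟨N, hN⟩ := ProfiniteGrp.exist_openNormalSubgroup_sub_open_nhds_of_one hV h1
  obtain ⟨i, hi⟩ := exists_lowerPCentral_le hG N.toSubgroup N.isOpen'
  exact ⟨i, fun x hx => hN (hi hx)⟩

end LowerPCentral

/-! ### The `p`-power map on the layers of a uniform group. -/

section PowerMap

open scoped commutatorElement

variable {p : ℕ} {G : Type*} [Group G] [TopologicalSpace G] [IsTopologicalGroup G]

theorem mk_lowerPCentral_comm {i : ℕ} {x : G} (hx : x ∈ lowerPCentral p G i) (g : G) :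
    Commute (x : G ⧸ lowerPCentral p G (i + 1)) g :=
  (isPCentralFiltration_lowerPCentral.mk_comm hx g).symm

/-- For odd `p`, the `p`-power map is multiplicative modulo `P (i + 1)` on elements whose commutator
lies in `P i`. -/
theorem mk_mul_pow_of_odd [hp : Fact p.Prime] (hp2 : p ≠ 2) {i : ℕ} {x y : G}
    (h : ⁅y⁻¹, x⁻¹⁆ ∈ lowerPCentral p G i) :
    (((x * y) ^ p : G) : G ⧸ lowerPCentral p G (i + 1)) = (x ^ p * y ^ p : G) := by
  have h1 := mul_pow_of_commutator_central (x := (x : G ⧸ lowerPCentral p G (i + 1))) (y := y)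
    (z := (⁅y⁻¹, x⁻¹⁆ : G)) (by
      rw [← QuotientGroup.mk_mul, ← QuotientGroup.mk_mul, ← QuotientGroup.mk_mul,
        commutatorElement_def]
      congr 1
      group) (mk_lowerPCentral_comm h x) (mk_lowerPCentral_comm h y) p
  have hz : ((⁅y⁻¹, x⁻¹⁆ : G) : G ⧸ lowerPCentral p G (i + 1)) ^ p = 1 := by
    rw [← QuotientGroup.mk_pow, QuotientGroup.eq_one_iff]
    exact pow_mem_lowerPCentral_succ h
  obtain ⟨c, hc⟩ : p ∣ p.choose 2 :=
    hp.out.dvd_choose_self two_ne_zero (lt_of_le_of_ne hp.out.two_le (Ne.symm hp2))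
  rw [hc, pow_mul, hz, one_pow, mul_one] at h1
  exact h1

variable (p G) in
/-- The consequence of powerfulness that drives the analysis of the `p`-power map: commutators with
`P i` are, modulo `P (i + 2)`, `p`-th powers of elements of `P i`; for `p = 2` they are trivial. -/
def CommutatorsArePowers (i : ℕ) : Prop :=
  ∀ x ∈ lowerPCentral p G i, ∀ g, (p = 2 → g * x * g⁻¹ * x⁻¹ ∈ lowerPCentral p G (i + 2)) ∧
    ∃ w ∈ lowerPCentral p G i,
      ((g * x * g⁻¹ * x⁻¹ : G) : G ⧸ lowerPCentral p G (i + 2)) = (w ^ p : G)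

theorem commutatorElement_inv_inv_mem {i : ℕ} {x : G} (hx : x ∈ lowerPCentral p G i) (y : G) :
    ⁅y⁻¹, x⁻¹⁆ ∈ lowerPCentral p G (i + 1) := by
  have := commutator_mem_lowerPCentral_succ (Subgroup.inv_mem _ hx) y⁻¹
  rwa [← commutatorElement_def] at this

/-- The `p`-power map is multiplicative on the layers of the lower `p`-central series. -/
theorem mk_mul_pow [Fact p.Prime] {i : ℕ}
    (h2 : p = 2 → ∀ x ∈ lowerPCentral p G i, ∀ g, g * x * g⁻¹ * x⁻¹ ∈ lowerPCentral p G (i + 2))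
    {x y : G} (hx : x ∈ lowerPCentral p G i) :
    (((x * y) ^ p : G) : G ⧸ lowerPCentral p G (i + 2)) = (x ^ p * y ^ p : G) := by
  by_cases hp2 : p = 2
  · have h := h2 hp2 x hx y
    rw [← QuotientGroup.eq_one_iff] at h
    have hcomm : Commute (x : G ⧸ lowerPCentral p G (i + 2)) y := by
      simp only [QuotientGroup.mk_mul, QuotientGroup.mk_inv] at h
      rw [mul_inv_eq_one, mul_inv_eq_iff_eq_mul] at h
      exact h.symm
    exact hcomm.mul_pow p
  · exact mk_mul_pow_of_odd hp2 (commutatorElement_inv_inv_mem hx y)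

/-- The subgroup of elements of `G` that are `p`-th powers of elements of `P i` modulo
`P (i + 2)`. -/
def powerSubgroup [Fact p.Prime] (i : ℕ)
    (h2 : p = 2 → ∀ x ∈ lowerPCentral p G i, ∀ g, g * x * g⁻¹ * x⁻¹ ∈ lowerPCentral p G (i + 2)) :
    Subgroup G where
  carrier := {g | ∃ w ∈ lowerPCentral p G i, (g : G ⧸ lowerPCentral p G (i + 2)) = (w ^ p : G)}
  one_mem' := ⟨1, Subgroup.one_mem _, by rw [one_pow]⟩
  mul_mem' := by
    rintro a b ⟨v, hv, ha⟩ ⟨w, hw, hb⟩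
    exact ⟨v * w, Subgroup.mul_mem _ hv hw, by
      rw [mk_mul_pow h2 hv, QuotientGroup.mk_mul, QuotientGroup.mk_mul, ha, hb]⟩
  inv_mem' := by
    rintro a ⟨v, hv, ha⟩
    exact ⟨v⁻¹, Subgroup.inv_mem _ hv, by
      rw [inv_pow, QuotientGroup.mk_inv, QuotientGroup.mk_inv, ha]⟩

theorem isClosed_powerSubgroup [Fact p.Prime] (i : ℕ)
    (hopen : IsOpen (lowerPCentral p G (i + 2) : Set G))
    (h2 : p = 2 → ∀ x ∈ lowerPCentral p G i, ∀ g, g * x * g⁻¹ * x⁻¹ ∈ lowerPCentral p G (i + 2)) :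
    IsClosed (powerSubgroup i h2 : Set G) := by
  refine Subgroup.isClosed_of_isOpen _ (Subgroup.isOpen_mono (fun x hx => ?_) hopen)
  exact ⟨1, Subgroup.one_mem _, by rw [one_pow, (QuotientGroup.eq_one_iff x).2 hx]; rfl⟩

/-- If commutators are powers, then every element of `P (i + 1)` is a `p`-th power modulo
`P (i + 2)`. -/
theorem CommutatorsArePowers.exists_pow [Fact p.Prime] {i : ℕ}
    (h : CommutatorsArePowers p G i) (hopen : IsOpen (lowerPCentral p G (i + 2) : Set G))
    {g : G} (hg : g ∈ lowerPCentral p G (i + 1)) :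
    ∃ w ∈ lowerPCentral p G i, (g : G ⧸ lowerPCentral p G (i + 2)) = (w ^ p : G) := by
  have h2 : p = 2 → ∀ x ∈ lowerPCentral p G i, ∀ g,
      g * x * g⁻¹ * x⁻¹ ∈ lowerPCentral p G (i + 2) := fun hp x hx g => (h x hx g).1 hp
  exact lowerPCentral_succ_le (isClosed_powerSubgroup i hopen h2) (fun x hx => ⟨x, hx, rfl⟩)
    (fun x hx g => (h x hx g).2) hg

/-- Take `x` to be `w ^ p` modulo `P (i + 2)`, and let `c` be the commutator of `g` and `w`. Modulo
`P (i + 3)` the commutator of `g` and `x` is `(c * w) ^ p * (w ^ p)⁻¹`, which collapses to `c ^ p`.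
So `c` is the required root; for `p = 2` it lies in `P (i + 2)`, and its square in `P (i + 3)`. -/
theorem CommutatorsArePowers.succ [Fact p.Prime] {i : ℕ}
    (h : CommutatorsArePowers p G i) (hopen : IsOpen (lowerPCentral p G (i + 2) : Set G)) :
    CommutatorsArePowers p G (i + 1) := by
  intro x hx g
  obtain ⟨w, hw, hxw⟩ := h.exists_pow hopen hx
  have hc := commutator_mem_lowerPCentral_succ hw g
  have ht : w ^ p * x⁻¹ ∈ lowerPCentral p G (i + 2) := by
    rw [← QuotientGroup.eq_one_iff, QuotientGroup.mk_mul, QuotientGroup.mk_inv, hxw, mul_inv_cancel]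
  have h1 : ((g * x * g⁻¹ * x⁻¹ : G) : G ⧸ lowerPCentral p G (i + 3)) =
      ((g * w * g⁻¹ * w⁻¹ * w) ^ p * (w ^ p)⁻¹ : G) := by
    -- The discrepancy `w ^ p * x⁻¹` is central modulo `P (i + 3)`, so it drops out of the
    -- commutator.
    have h3 := mk_lowerPCentral_comm ht (g * x * g⁻¹ * x⁻¹)
    have h4 : (g * w * g⁻¹ * w⁻¹ * w) ^ p * (w ^ p)⁻¹ = g * (w ^ p * x⁻¹) * g⁻¹ * (w ^ p * x⁻¹)⁻¹ *
        ((w ^ p * x⁻¹) * (g * x * g⁻¹ * x⁻¹) * (w ^ p * x⁻¹)⁻¹) := by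
      rw [inv_mul_cancel_right, conj_pow]
      group
    generalize g * x * g⁻¹ * x⁻¹ = c at h3 h4 ⊢
    rw [h4, QuotientGroup.mk_mul,
      (QuotientGroup.eq_one_iff _).2 (commutator_mem_lowerPCentral_succ ht g), one_mul,
      QuotientGroup.mk_mul, QuotientGroup.mk_mul, h3.eq, QuotientGroup.mk_inv,
      mul_inv_cancel_right]
  have h5 : (((g * w * g⁻¹ * w⁻¹ * w) ^ p : G) : G ⧸ lowerPCentral p G (i + 3)) =
      ((g * w * g⁻¹ * w⁻¹) ^ p * w ^ p : G) := by
    by_cases hp2 : p = 2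
    · have h6 := mk_lowerPCentral_comm ((h w hw g).1 hp2) w
      exact h6.mul_pow p
    · exact mk_mul_pow_of_odd hp2 (commutatorElement_inv_inv_mem hc w)
  have h7 : ((g * x * g⁻¹ * x⁻¹ : G) : G ⧸ lowerPCentral p G (i + 3)) =
      ((g * w * g⁻¹ * w⁻¹) ^ p : G) := by
    rw [h1, QuotientGroup.mk_mul, h5, ← QuotientGroup.mk_mul, mul_inv_cancel_right]
  refine ⟨fun hp2 => ?_, _, hc, h7⟩
  rw [← QuotientGroup.eq_one_iff, h7, QuotientGroup.eq_one_iff]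
  exact pow_mem_lowerPCentral_succ ((h w hw g).1 hp2)

/-- Powerfulness is the base case. For `p = 2` the exponent `4` puts commutators two layers down,
since a fourth power is a square of a square. -/
theorem IsPowerfulGroup.commutatorsArePowers [Fact p.Prime] (hG : IsPowerfulGroup p G)
    (hopen : ∀ i, IsOpen (lowerPCentral p G i : Set G)) (i : ℕ) : CommutatorsArePowers p G i := by
  induction i with
  | succ i ih => exact ih.succ (hopen _)
  | zero =>
    have hmem : ∀ x g : G, g * x * g⁻¹ * x⁻¹ ∈ closedPower (⊤ : Subgroup G) (if p = 2 then 4 else p) := by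
      intro x g
      rw [← commutatorElement_def]
      exact hG (Subgroup.le_topologicalClosure _
        (Subgroup.commutator_mem_commutator (Subgroup.mem_top g) (Subgroup.mem_top x)))
    by_cases hp2 : p = 2
    · have h4 : ∀ x g : G, g * x * g⁻¹ * x⁻¹ ∈ lowerPCentral p G 2 := by
        intro x g
        have := hmem x g
        rw [if_pos hp2] at this
        refine closedSpan_le (isClosed_lowerPCentral 2) ?_ this
        rintro _ ⟨y, -, rfl⟩
        have := pow_mem_lowerPCentral_succ (p := p)
          (pow_mem_lowerPCentral_succ (p := p) (i := 0) (Subgroup.mem_top y))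
        rw [← pow_mul] at this
        subst hp2
        exact this
      refine fun x _ g => ⟨fun _ => h4 x g, 1, Subgroup.one_mem _, ?_⟩
      rw [one_pow]
      exact (QuotientGroup.eq_one_iff _).2 (h4 x g)
    · refine fun x _ g => ⟨fun h => absurd h hp2, ?_⟩
      have := hmem x g
      rw [if_neg hp2] at this
      refine closedSpan_le
        (isClosed_powerSubgroup 0 (hopen _) fun h => absurd h hp2) ?_ this
      rintro _ ⟨y, -, rfl⟩
      exact ⟨y, Subgroup.mem_top y, rfl⟩

theorem IsUniformProPGroup.commutatorsArePowers [Fact p.Prime] (hG : IsUniformProPGroup p G)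
    (i : ℕ) : CommutatorsArePowers p G i :=
  hG.powerful.commutatorsArePowers hG.isOpen_lowerPCentral i

theorem IsUniformProPGroup.exists_pow [Fact p.Prime] (hG : IsUniformProPGroup p G) {i : ℕ}
    {g : G} (hg : g ∈ lowerPCentral p G (i + 1)) :
    ∃ w ∈ lowerPCentral p G i, (g : G ⧸ lowerPCentral p G (i + 2)) = (w ^ p : G) :=
  (hG.commutatorsArePowers i).exists_pow (hG.isOpen_lowerPCentral _) hg

theorem IsUniformProPGroup.mk_mul_pow [Fact p.Prime] (hG : IsUniformProPGroup p G) {i : ℕ}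
    {x : G} (hx : x ∈ lowerPCentral p G i) (y : G) :
    (((x * y) ^ p : G) : G ⧸ lowerPCentral p G (i + 2)) = (x ^ p * y ^ p : G) :=
  _root_.mk_mul_pow (fun hp x hx g => (hG.commutatorsArePowers i x hx g).1 hp) hx

/-- In a uniform group the `p`-power map is injective on the layers of the lower `p`-central
series. -/
theorem IsUniformProPGroup.mem_of_pow_mem [Fact p.Prime] (hG : IsUniformProPGroup p G) {i : ℕ}
    {x : G} (hx : x ∈ lowerPCentral p G i) (hxp : x ^ p ∈ lowerPCentral p G (i + 2)) :
    x ∈ lowerPCentral p G (i + 1) := by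
  let P := lowerPCentral p G
  let V := P i ⧸ (P (i + 1)).subgroupOf (P i)
  let V' := P (i + 1) ⧸ (P (i + 2)).subgroupOf (P (i + 1))
  let f : P i →* V' :=
    { toFun := fun x => QuotientGroup.mk ⟨x.1 ^ p, pow_mem_lowerPCentral_succ x.2⟩
      map_one' := (QuotientGroup.eq_one_iff _).2 (by
        rw [Subgroup.mem_subgroupOf]
        simp)
      map_mul' := fun x y => by
        rw [← QuotientGroup.mk_mul, QuotientGroup.eq, Subgroup.mem_subgroupOf]
        exact QuotientGroup.eq.1 (hG.mk_mul_pow x.2 y.1) }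
  let θ : V →* V' := QuotientGroup.lift _ f fun x hx =>
    (QuotientGroup.eq_one_iff _).2 (pow_mem_lowerPCentral_succ hx)
  -- Uniformity enters here: the power map is a surjection between finite layers of equal order.
  have hcard : Nat.card V = Nat.card V' := (hG.index_eq i).trans (hG.index_eq (i + 1)).symm
  have hfin : Finite V := by
    refine Nat.finite_of_card_ne_zero ?_
    have : Nat.card V = (P 1).index := hG.index_eq i
    rw [this]
    exact (finiteIndex_lowerPCentral_one hG.finitelyGenerated).index_ne_zero
  have hsurj : Function.Surjective θ := by
    intro v
    obtain ⟨g, rfl⟩ := QuotientGroup.mk_surjective v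
    obtain ⟨w, hw, hgw⟩ := hG.exists_pow g.2
    refine ⟨QuotientGroup.mk ⟨w, hw⟩, ?_⟩
    have h1 : (w ^ p)⁻¹ * g.1 ∈ P (i + 2) := QuotientGroup.eq.1 hgw.symm
    exact QuotientGroup.eq.2 h1
  have hinj : Function.Injective θ := (hsurj.bijective_of_nat_card_le hcard.le).1
  have h1 : θ (QuotientGroup.mk ⟨x, hx⟩) = 1 := (QuotientGroup.eq_one_iff _).2 hxp
  exact (QuotientGroup.eq_one_iff (N := (P (i + 1)).subgroupOf (P i)) _).1
    ((injective_iff_map_eq_one θ).1 hinj _ h1)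

/-- A closed subgroup of a uniform group that generates it modulo `P 1` is the whole group. -/
theorem IsUniformProPGroup.eq_top_of_sup_eq_top [Fact p.Prime] [CompactSpace G]
    [TotallyDisconnectedSpace G] [T2Space G] (hG : IsUniformProPGroup p G)
    (hp : ∀ U : OpenNormalSubgroup G, IsPGroup p (G ⧸ U.toSubgroup)) {K : Subgroup G}
    (hK : IsClosed (K : Set G)) (h : ∀ g, ∃ k ∈ K, k⁻¹ * g ∈ lowerPCentral p G 1) : K = ⊤ := by
  have key : ∀ i, ∀ g, ∃ k ∈ K, k⁻¹ * g ∈ lowerPCentral p G (i + 1) := by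
    intro i
    induction i with
    | zero => exact h
    | succ i ih =>
      intro g
      obtain ⟨k, hk, hu⟩ := ih g
      obtain ⟨w, hw, hgw⟩ := hG.exists_pow hu
      obtain ⟨l, hl, ht⟩ := ih w
      have hl' : l ∈ lowerPCentral p G i := by
        have := Subgroup.mul_mem _ hw (Subgroup.inv_mem _
          (isPCentralFiltration_lowerPCentral.anti i.le_succ ht))
        simpa using this
      -- Modulo `P (i + 2)` the remainder `k⁻¹ * g` is `w ^ p`, and this equals `l ^ p` because `w`
      -- and `l` agree modulo `P (i + 1)`.
      refine ⟨k * l ^ p, K.mul_mem hk (K.pow_mem hl p), ?_⟩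
      have h1 := hG.mk_mul_pow hl' (l⁻¹ * w)
      rw [mul_inv_cancel_left, ← hgw, QuotientGroup.mk_mul _ (l ^ p),
        (QuotientGroup.eq_one_iff _).2 (pow_mem_lowerPCentral_succ ht), mul_one] at h1
      rw [mul_inv_rev, mul_assoc]
      exact QuotientGroup.eq.1 h1.symm
  rw [eq_top_iff]
  intro g _
  by_contra hg
  obtain ⟨i, hi⟩ := exists_lowerPCentral_subset hp (V := {u | g * u⁻¹ ∉ K})
    (hK.isOpen_compl.preimage (by fun_prop : Continuous fun u : G => g * u⁻¹)) (by simpa using hg)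
  obtain ⟨k, hk, hu⟩ := key i g
  have := hi (isPCentralFiltration_lowerPCentral.anti i.le_succ hu)
  apply this
  simpa using hk

end PowerMap

/-! ### Restriction of the series to a subgroup generated by part of a basis. -/

section Basis

variable {p : ℕ} {G H : Type*} [Group G] [TopologicalSpace G] [IsTopologicalGroup G]
  [Group H] [TopologicalSpace H] [IsTopologicalGroup H]

theorem lowerPCentral_le_comap (φ : H →ₜ* G) (i : ℕ) :
    lowerPCentral p H i ≤ (lowerPCentral p G i).comap φ.toMonoidHom := by
  induction i with
  | zero => exact fun _ _ => Subgroup.mem_top _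
  | succ i ih =>
    refine lowerPCentral_succ_le ((isClosed_lowerPCentral (i + 1)).preimage φ.continuous_toFun)
      (fun x hx => ?_) fun x hx g => ?_
    · rw [Subgroup.mem_comap, map_pow]
      exact pow_mem_lowerPCentral_succ (ih hx)
    · rw [Subgroup.mem_comap, map_mul, map_mul, map_mul, map_inv, map_inv]
      exact commutator_mem_lowerPCentral_succ (ih hx) _

theorem normal_of_lowerPCentral_one_le {K : Subgroup G} (hK : lowerPCentral p G 1 ≤ K) :
    K.Normal where
  conj_mem x hx g := by
    have := K.mul_mem (hK (commutator_mem_lowerPCentral_succ (i := 0) (Subgroup.mem_top x) g)) hx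
    rwa [inv_mul_cancel_right] at this

/-- A basis is independent modulo `P 1`. -/
theorem IsGeneratingBasis.notMem_sup_lowerPCentral [Fact p.Prime] [CompactSpace G]
    [TotallyDisconnectedSpace G] [T2Space G] (hG : IsUniformProPGroup p G)
    (hp : ∀ U : OpenNormalSubgroup G, IsPGroup p (G ⧸ U.toSubgroup)) {I : Finset ℕ} {x : ℕ → G}
    (hx : IsGeneratingBasis I x) {i : ℕ} (hi : i ∈ I) :
    x i ∉ Subgroup.closure (x '' (I.erase i : Set ℕ)) ⊔ lowerPCentral p G 1 := by
  intro hxi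
  let K := closedSpan (x '' (I.erase i : Set ℕ))
  have hMK : Subgroup.closure (x '' (I.erase i : Set ℕ)) ⊔ lowerPCentral p G 1 ≤
      K ⊔ lowerPCentral p G 1 := sup_le_sup_right (Subgroup.le_topologicalClosure _) _
  have htop : K ⊔ lowerPCentral p G 1 = ⊤ := by
    rw [eq_top_iff, ← hx.generates]
    refine closedSpan_le (Subgroup.isClosed_of_isOpen _
      (Subgroup.isOpen_mono le_sup_right (hG.isOpen_lowerPCentral 1))) ?_
    rintro _ ⟨j, hj, rfl⟩
    by_cases hji : j = i
    · rw [hji]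
      exact hMK hxi
    · exact Subgroup.mem_sup_left
        (subset_closedSpan _ ⟨j, Finset.mem_erase.2 ⟨hji, hj⟩, rfl⟩)
  -- The remaining generators span modulo `P 1`, hence topologically generate, contradicting
  -- minimality of the basis.
  have hK : K = ⊤ := by
    refine hG.eq_top_of_sup_eq_top hp (Subgroup.isClosed_topologicalClosure _) fun g => ?_
    obtain ⟨k, hk, u, hu, rfl⟩ := Subgroup.mem_sup_of_normal_right.1 (htop.ge (Subgroup.mem_top g))
    exact ⟨k, hk, by rwa [inv_mul_cancel_left]⟩
  classical
  have h1 := hx.card_le ((I.erase i).image x) (by rw [Finset.coe_image]; exact hK)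
  have h2 := h1.trans Finset.card_image_le
  exact absurd (Finset.card_erase_lt_of_mem hi) h2.not_gt

/-- The case of the first layer, by linear independence. If the exponent `a` of some `z i` is prime
to `p`, then `x i ^ a` and `x i ^ p` both lie in the span of the other `x j` and `P 1`, hence so
does `x i`. Thus `p` divides `a`, and the factor `z i ^ a` already lies in `P 1`. -/
theorem mem_lowerPCentral_one_of_basis [Fact p.Prime] [CompactSpace G]
    [TotallyDisconnectedSpace G] [T2Space G] (hG : IsUniformProPGroup p G)
    (hp : ∀ U : OpenNormalSubgroup G, IsPGroup p (G ⧸ U.toSubgroup))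
    (hH : IsUniformProPGroup p H) (φ : H →ₜ* G) {I J : Finset ℕ} (hJI : J ⊆ I)
    {x : ℕ → G} (hx : IsGeneratingBasis I x) {z : ℕ → H}
    (hz : closedSpan (z '' (J : Set ℕ)) = ⊤) (hzx : ∀ i ∈ J, φ (z i) = x i) {h : H}
    (hh : φ h ∈ lowerPCentral p G 1) : h ∈ lowerPCentral p H 1 := by
  have key : ∀ s : Finset ℕ, s ⊆ J →
      ∀ h ∈ Subgroup.closure (z '' (s : Set ℕ)) ⊔ lowerPCentral p H 1,
      φ h ∈ lowerPCentral p G 1 → h ∈ lowerPCentral p H 1 := by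
    intro s
    induction s using Finset.induction_on with
    | empty =>
      intro _ h hh _
      simpa using hh
    | insert i s his ih =>
      intro hs h hh hφh
      have hiJ : i ∈ J := hs (Finset.mem_insert_self i s)
      have hsJ : s ⊆ J := (Finset.subset_insert i s).trans hs
      have := normal_of_lowerPCentral_one_le (p := p)
        (K := Subgroup.closure (z '' (s : Set ℕ)) ⊔ lowerPCentral p H 1) le_sup_right
      rw [Finset.coe_insert, Set.image_insert_eq, Set.insert_eq, Subgroup.closure_union,
        ← Subgroup.zpowers_eq_closure, sup_assoc] at hh
      obtain ⟨y, ⟨a, rfl⟩, t, ht, rfl⟩ := Subgroup.mem_sup_of_normal_right.1 hh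
      simp only [map_mul] at hφh
      by_cases ha : (p : ℤ) ∣ a
      · obtain ⟨b, rfl⟩ := ha
        have hza : z i ^ ((p : ℤ) * b) ∈ lowerPCentral p H 1 := by
          rw [zpow_mul, zpow_natCast]
          exact Subgroup.zpow_mem _ (pow_mem_lowerPCentral_succ (i := 0) (Subgroup.mem_top _)) b
        exact Subgroup.mul_mem _ hza (ih hsJ t ht
          ((Subgroup.mul_mem_cancel_left (lowerPCentral p G 1)
            (lowerPCentral_le_comap φ 1 hza)).1 hφh))
      · exfalso
        refine hx.notMem_sup_lowerPCentral hG hp (hJI hiJ) ?_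
        let M := Subgroup.closure (x '' (I.erase i : Set ℕ)) ⊔ lowerPCentral p G 1
        have hφt : φ t ∈ M := by
          have : Subgroup.closure (z '' (s : Set ℕ)) ⊔ lowerPCentral p H 1 ≤
              M.comap φ.toMonoidHom := by
            refine sup_le ((Subgroup.closure_le _).2 ?_) ((lowerPCentral_le_comap φ 1).trans
              (Subgroup.comap_mono le_sup_right))
            rintro _ ⟨j, hj, rfl⟩
            refine Subgroup.mem_sup_left (Subgroup.subset_closure ⟨j, ?_, (hzx j (hsJ hj)).symm⟩)
            exact Finset.mem_erase.2 ⟨fun hji => his (hji ▸ hj), hJI (hsJ hj)⟩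
          exact this ht
        have hxa : x i ^ a ∈ M := by
          have := (Subgroup.mul_mem_cancel_right M hφt).1 (Subgroup.mem_sup_right hφh)
          rwa [map_zpow, hzx i hiJ] at this
        have hxp : x i ^ (p : ℤ) ∈ M := by
          rw [zpow_natCast]
          exact Subgroup.mem_sup_right
            (pow_mem_lowerPCentral_succ (i := 0) (Subgroup.mem_top _))
        obtain ⟨v, w, hvw⟩ := ((Nat.prime_iff_prime_int.1 Fact.out).coprime_iff_not_dvd).2 ha
        have h1 := M.mul_mem (M.zpow_mem hxp v) (M.zpow_mem hxa w)
        rwa [← zpow_mul, ← zpow_mul, ← zpow_add, mul_comm _ v, mul_comm _ w, hvw, zpow_one] at h1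
  have htop : Subgroup.closure (z '' (J : Set ℕ)) ⊔ lowerPCentral p H 1 = ⊤ := by
    rw [eq_top_iff, ← hz]
    exact closedSpan_le (Subgroup.isClosed_of_isOpen _
      (Subgroup.isOpen_mono le_sup_right (hH.isOpen_lowerPCentral 1)))
      (Subgroup.subset_closure.trans (SetLike.coe_subset_coe.2 le_sup_left))
  exact key J subset_rfl h (htop.ge (Subgroup.mem_top h)) hh

/-- A uniform group generated by part of a basis of a uniform group `G` carries the filtration
induced by the lower `p`-central series of `G`. -/
theorem comap_lowerPCentral_of_basis [Fact p.Prime] [CompactSpace G]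
    [TotallyDisconnectedSpace G] [T2Space G] (hG : IsUniformProPGroup p G)
    (hp : ∀ U : OpenNormalSubgroup G, IsPGroup p (G ⧸ U.toSubgroup))
    (hH : IsUniformProPGroup p H) (φ : H →ₜ* G) {I J : Finset ℕ} (hJI : J ⊆ I)
    {x : ℕ → G} (hx : IsGeneratingBasis I x) {z : ℕ → H}
    (hz : closedSpan (z '' (J : Set ℕ)) = ⊤) (hzx : ∀ i ∈ J, φ (z i) = x i) (i : ℕ) :
    (lowerPCentral p G i).comap φ.toMonoidHom = lowerPCentral p H i := by
  refine le_antisymm ?_ (lowerPCentral_le_comap φ i)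
  -- Injectivity on each layer. A `p`-th root `w` of `h` reduces layer `i + 1` to layer `i`, because
  -- the power map of `G` is injective on layers.
  have step : ∀ i, ∀ h ∈ lowerPCentral p H i, φ h ∈ lowerPCentral p G (i + 1) →
      h ∈ lowerPCentral p H (i + 1) := by
    intro i
    induction i with
    | zero => exact fun h _ hh => mem_lowerPCentral_one_of_basis hG hp hH φ hJI hx hz hzx hh
    | succ i ih =>
      intro h hh hφh
      obtain ⟨w, hw, hhw⟩ := hH.exists_pow hh
      have ht : (w ^ p)⁻¹ * h ∈ lowerPCentral p H (i + 2) := QuotientGroup.eq.1 hhw.symm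
      have hφw : φ w ^ p ∈ lowerPCentral p G (i + 2) := by
        have := Subgroup.mul_mem _ hφh (Subgroup.inv_mem _ (lowerPCentral_le_comap φ _ ht))
        have h2 : φ h * (φ ((w ^ p)⁻¹ * h))⁻¹ = φ w ^ p := by simp
        rwa [← h2]
      have hw' := ih w hw (hG.mem_of_pow_mem (lowerPCentral_le_comap φ _ hw) hφw)
      have := Subgroup.mul_mem _ (pow_mem_lowerPCentral_succ hw') ht
      rwa [mul_inv_cancel_left] at this
  induction i with
  | zero => exact fun _ _ => Subgroup.mem_top _
  | succ i ih =>
    exact fun h hh => step i h (ih (isPCentralFiltration_lowerPCentral.anti i.le_succ hh)) hh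

end Basis

/-! ### Completions and existence of pushouts of pro-`p` groups. -/

section Pushout

theorem MonoidHom.continuous_of_isOpen_ker {A D : Type*} [Group A] [TopologicalSpace A]
    [IsTopologicalGroup A] [Group D] [TopologicalSpace D] [DiscreteTopology D] (f : A →* D)
    (hf : IsOpen (f.ker : Set A)) : Continuous f := by
  refine continuous_of_continuousAt_one f ?_
  rw [ContinuousAt, map_one, nhds_discrete D, Filter.tendsto_pure]
  exact hf.mem_nhds f.ker.one_mem

/-- A basic neighbourhood of `1` restricts finitely many coordinates, so the largest of the finitely
many exponents serves. -/
theorem Subgroup.isOpen_isPGroup_of_pi {p : ℕ} {ι : Type*} {V : ι → Type*} [∀ i, Group (V i)]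
    [∀ i, TopologicalSpace (V i)] (hV : ∀ i, IsPGroup p (V i))
    {C : Subgroup (∀ i, V i)} {U : Subgroup C} [U.Normal] (hU : IsOpen (U : Set C)) :
    IsPGroup p (C ⧸ U) := by
  intro q
  obtain ⟨x, rfl⟩ := QuotientGroup.mk_surjective q
  obtain ⟨O, hO, hOU⟩ := isOpen_induced_iff.1 hU
  have h1 : (1 : ∀ i, V i) ∈ O := by
    have : (1 : C) ∈ Subtype.val ⁻¹' O := hOU ▸ U.one_mem
    exact this
  obtain ⟨I, u, hu, huO⟩ := isOpen_pi_iff.1 hO 1 h1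
  choose k hk using fun i => hV i (x.1 i)
  refine ⟨I.sup k, ?_⟩
  rw [← QuotientGroup.mk_pow, QuotientGroup.eq_one_iff]
  have h2 : (x ^ p ^ I.sup k : C).1 ∈ O := by
    refine huO fun i hi => ?_
    have h3 : (x.1 i) ^ p ^ I.sup k = 1 := by
      obtain ⟨c, hc⟩ := pow_dvd_pow p (Finset.le_sup (f := k) hi)
      rw [hc, pow_mul, hk, one_pow]
    change (x.1 i) ^ p ^ I.sup k ∈ u i
    rw [h3]
    exact (hu i hi).2
  have h4 : (x ^ p ^ I.sup k : C) ∈ Subtype.val ⁻¹' O := h2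
  rw [hOU] at h4
  exact h4

/-- A homomorphism from a group to a pro-`p` group extends along a homomorphism with dense image to
a profinite group, provided that it is continuous for the induced topology. -/
theorem exists_continuous_extension {Γ C P : Type*} [Group Γ] [Group C] [TopologicalSpace C]
    [IsTopologicalGroup C] [CompactSpace C] [T2Space C] [Group P] [TopologicalSpace P]
    [IsTopologicalGroup P] [CompactSpace P] [T2Space P] [TotallyDisconnectedSpace P]
    (ι : Γ →* C) (hι : DenseRange ι) (f : Γ →* P)
    (h : ∀ V : OpenNormalSubgroup P, ∃ g : C →ₜ* P ⧸ V.toSubgroup, ∀ γ, g (ι γ) = (f γ : P ⧸ _)) :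
    ∃ F : C →ₜ* P, ∀ γ, F (ι γ) = f γ := by
  -- The closure of the graph of `f` over `ι` is itself a graph. Its projection to `C` is onto by
  -- compactness and density, and injective because modulo each `V` the second coordinate is a
  -- continuous function of the first. A continuous bijection from a compact to a Hausdorff space is
  -- a homeomorphism.
  let K : Subgroup (C × P) := (ι.prod f).range.topologicalClosure
  have hKc : IsClosed (K : Set (C × P)) := Subgroup.isClosed_topologicalClosure _
  have hK : ∀ γ, (ι γ, f γ) ∈ K := fun γ => Subgroup.le_topologicalClosure _ ⟨γ, rfl⟩
  have : CompactSpace K := isCompact_iff_compactSpace.1 hKc.isCompact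
  let q : K →* C := (MonoidHom.fst C P).comp K.subtype
  have hqc : Continuous q := continuous_fst.comp continuous_subtype_val
  have hinj : Function.Injective q := by
    rw [injective_iff_map_eq_one]
    rintro ⟨⟨c, x⟩, hx⟩ hc
    have hc : c = 1 := hc
    subst hc
    have hx1 : x = 1 := by
      by_contra hne
      obtain ⟨V, hV⟩ := ProfiniteGrp.exist_openNormalSubgroup_sub_open_nhds_of_one
        (isOpen_compl_singleton (x := x)) (fun h => hne h.symm)
      obtain ⟨g, hg⟩ := h V
      have : DiscreteTopology (P ⧸ V.toSubgroup) := QuotientGroup.discreteTopology V.isOpen'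
      have hcl : IsClosed {y : C × P | g y.1 = (y.2 : P ⧸ V.toSubgroup)} :=
        isClosed_eq (g.continuous_toFun.comp continuous_fst)
          (QuotientGroup.continuous_mk.comp continuous_snd)
      have hmem : (1, x) ∈ {y : C × P | g y.1 = (y.2 : P ⧸ V.toSubgroup)} := by
        refine closure_minimal ?_ hcl hx
        rintro _ ⟨γ, rfl⟩
        exact hg γ
      have hxV : (x : P ⧸ V.toSubgroup) = 1 := by
        have : g 1 = (x : P ⧸ V.toSubgroup) := hmem
        rw [← this, map_one]
      exact hV ((QuotientGroup.eq_one_iff x).1 hxV) rfl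
    subst hx1
    rfl
  have hsurj : Function.Surjective q := by
    rw [← Set.range_eq_univ, ← (isCompact_range hqc).isClosed.closure_eq, ← Set.univ_subset_iff,
      ← hι.closure_range]
    refine closure_mono ?_
    rintro _ ⟨γ, rfl⟩
    exact ⟨⟨_, hK γ⟩, rfl⟩
  let e : K ≃* C := MulEquiv.ofBijective q ⟨hinj, hsurj⟩
  have he : Continuous e.symm := (Continuous.homeoOfEquivCompactToT2 (f := e.toEquiv) hqc).symm.continuous
  refine ⟨⟨((MonoidHom.snd C P).comp K.subtype).comp e.symm.toMonoidHom,
    (continuous_snd.comp continuous_subtype_val).comp he⟩, fun γ => ?_⟩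
  have h1 : e.symm (ι γ) = ⟨_, hK γ⟩ := by
    rw [MulEquiv.symm_apply_eq]
    rfl
  change (e.symm (ι γ)).1.2 = f γ
  rw [h1]

/-- The completion of a (discrete) group with respect to a set of normal subgroups whose quotients
are finite `p`-groups. -/
theorem exists_completion {p : ℕ} {Γ : Type u} [Group Γ] [TopologicalSpace Γ]
    [DiscreteTopology Γ] (S : Set (OpenNormalSubgroup Γ))
    (hfin : ∀ N ∈ S, Finite (Γ ⧸ N.toSubgroup)) (hp : ∀ N ∈ S, IsPGroup p (Γ ⧸ N.toSubgroup)) :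
    ∃ (C : ProPGrp.{u} p) (ι : Γ →* C.obj), DenseRange ι ∧
      (∀ γ, (∀ N ∈ S, γ ∈ N.toSubgroup) → ι γ = 1) ∧
      (∀ (A : Type u) [Group A] [TopologicalSpace A] [IsTopologicalGroup A] (g : A →* Γ),
        (∀ N ∈ S, IsOpen ((N.toSubgroup.comap g : Subgroup A) : Set A)) →
          Continuous fun a => ι (g a)) ∧
      ∀ (P : ProPGrp.{u} p) (f : Γ →* P.obj),
        (∀ V : OpenNormalSubgroup P.obj, ∃ N ∈ S, N.toSubgroup ≤ V.toSubgroup.comap f) →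
          ∃ F : C.obj →ₜ* P.obj, ∀ γ, F (ι γ) = f γ := by
  have hdisc : ∀ N : OpenNormalSubgroup Γ, DiscreteTopology (Γ ⧸ N.toSubgroup) := fun N =>
    QuotientGroup.discreteTopology N.isOpen'
  have hfin' : ∀ N : S, Finite (Γ ⧸ N.1.toSubgroup) := fun N => hfin N.1 N.2
  let W := ∀ N : S, Γ ⧸ N.1.toSubgroup
  let j : Γ →* W := MonoidHom.pi fun N : S => QuotientGroup.mk' N.1.toSubgroup
  let K : Subgroup W := j.range.topologicalClosure
  have hKc : IsClosed (K : Set W) := Subgroup.isClosed_topologicalClosure _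
  have : CompactSpace K := isCompact_iff_compactSpace.1 hKc.isCompact
  let C : ProPGrp.{u} p := ⟨ProfiniteGrp.of K, fun U =>
    Subgroup.isOpen_isPGroup_of_pi (fun N : S => hp N.1 N.2) U.isOpen'⟩
  have hj : ∀ γ, j γ ∈ K := fun γ => Subgroup.le_topologicalClosure _ ⟨γ, rfl⟩
  let ι : Γ →* K := j.codRestrict K hj
  have hι : DenseRange ι := by
    intro x
    rw [closure_subtype, ← Set.range_comp]
    exact x.2
  refine ⟨C, ι, hι, fun γ hγ => ?_, fun A _ _ _ g hg => ?_, fun P f hf => ?_⟩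
  · exact Subtype.ext (funext fun N => (QuotientGroup.eq_one_iff γ).2 (hγ N.1 N.2))
  · refine Continuous.subtype_mk (continuous_pi fun N => ?_) _
    refine ((QuotientGroup.mk' N.1.toSubgroup).comp g).continuous_of_isOpen_ker ?_
    rw [← MonoidHom.comap_ker, QuotientGroup.ker_mk']
    exact hg N.1 N.2
  · refine exists_continuous_extension (C := K) ι hι f fun V => ?_
    obtain ⟨N, hN, hNV⟩ := hf V
    let r : K →* P.obj ⧸ V.toSubgroup :=
      (QuotientGroup.map N.toSubgroup V.toSubgroup f hNV).comp
        ((Pi.evalMonoidHom (fun N : S => Γ ⧸ N.1.toSubgroup) ⟨N, hN⟩).comp K.subtype)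
    refine ⟨⟨r, ?_⟩, fun γ => rfl⟩
    exact (continuous_of_discreteTopology
      (f := QuotientGroup.map N.toSubgroup V.toSubgroup f hNV)).comp
      ((continuous_apply (⟨N, hN⟩ : S)).comp continuous_subtype_val)

/-- The morphism of pro-`p` groups defined by a continuous homomorphism. -/
def ProPGrp.ofHom {p : ℕ} {A B : ProPGrp.{u} p} (f : A.obj →ₜ* B.obj) : A ⟶ B :=
  ObjectProperty.homMk (ConcreteCategory.ofHom f)

theorem ProPGrp.hom_ext {p : ℕ} {A B : ProPGrp.{u} p} {f g : A ⟶ B}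
    (h : ∀ a, ProPGrp.toHom f a = ProPGrp.toHom g a) : f = g :=
  ObjectProperty.hom_ext _ (ProfiniteGrp.hom_ext (ContinuousMonoidHom.ext h))

/-- The pushout is a completion of the abstract free product, along the normal subgroups with finite
`p`-group quotient that are open on both factors and contain the amalgamation relations. Density of
the image gives uniqueness. -/
theorem ProPGrp.exists_isPushout {p : ℕ} {H G₁ G₂ : ProPGrp.{u} p} (φ₁ : H ⟶ G₁) (φ₂ : H ⟶ G₂) :
    ∃ (G : ProPGrp.{u} p) (ψ₁ : G₁ ⟶ G) (ψ₂ : G₂ ⟶ G), IsPushout φ₁ φ₂ ψ₁ ψ₂ := by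
  let Γ := Monoid.Coprod G₁.obj G₂.obj
  let _ : TopologicalSpace Γ := ⊥
  have : DiscreteTopology Γ := ⟨rfl⟩
  let i₁ : G₁.obj →* Γ := Monoid.Coprod.inl
  let i₂ : G₂.obj →* Γ := Monoid.Coprod.inr
  let S : Set (OpenNormalSubgroup Γ) := {N | Finite (Γ ⧸ N.toSubgroup) ∧
    IsPGroup p (Γ ⧸ N.toSubgroup) ∧ IsOpen ((N.toSubgroup.comap i₁ : Subgroup _) : Set G₁.obj) ∧
    IsOpen ((N.toSubgroup.comap i₂ : Subgroup _) : Set G₂.obj) ∧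
    ∀ h, i₁ (toHom φ₁ h) * (i₂ (toHom φ₂ h))⁻¹ ∈ N.toSubgroup}
  obtain ⟨C, ι, hι, hone, hcont, hlift⟩ :=
    exists_completion (p := p) S (fun N hN => hN.1) (fun N hN => hN.2.1)
  let ψ₁ : G₁ ⟶ C := ofHom ⟨ι.comp i₁, hcont _ i₁ fun N hN => hN.2.2.1⟩
  let ψ₂ : G₂ ⟶ C := ofHom ⟨ι.comp i₂, hcont _ i₂ fun N hN => hN.2.2.2.1⟩
  have hw : φ₁ ≫ ψ₁ = φ₂ ≫ ψ₂ := by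
    refine hom_ext fun h => ?_
    have := hone _ fun N hN => hN.2.2.2.2 h
    rw [map_mul, map_inv, mul_inv_eq_one] at this
    exact this
  refine ⟨C, ψ₁, ψ₂, ⟨⟨hw⟩, ⟨?_⟩⟩⟩
  have hdesc : ∀ s : Limits.PushoutCocone φ₁ φ₂, ∃ F : C ⟶ s.pt, ψ₁ ≫ F = s.inl ∧ ψ₂ ≫ F = s.inr := by
    intro s
    let f : Γ →* s.pt.obj :=
      Monoid.Coprod.lift (toHom s.inl).toMonoidHom (toHom s.inr).toMonoidHom
    have hf₁ : ∀ a, f (i₁ a) = toHom s.inl a := fun a => Monoid.Coprod.lift_apply_inl _ _ a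
    have hf₂ : ∀ a, f (i₂ a) = toHom s.inr a := fun a => Monoid.Coprod.lift_apply_inr _ _ a
    obtain ⟨F, hF⟩ := hlift s.pt f fun V => by
      refine ⟨⟨⟨V.toSubgroup.comap f, isOpen_discrete _⟩, inferInstance⟩, ?_, le_rfl⟩
      -- The quotient of `Γ` embeds in a finite `p`-group, which places the preimage of `V` in `S`.
      have hinj : Function.Injective (QuotientGroup.map (V.toSubgroup.comap f) V.toSubgroup f le_rfl) := by
        rw [injective_iff_map_eq_one]
        intro v hv
        obtain ⟨γ, rfl⟩ := QuotientGroup.mk_surjective v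
        exact (QuotientGroup.eq_one_iff γ).2 ((QuotientGroup.eq_one_iff (f γ)).1 hv)
      have : Finite (s.pt.obj ⧸ V.toSubgroup) := Subgroup.quotient_finite_of_isOpen _ V.isOpen'
      refine ⟨Finite.of_injective _ hinj, (s.pt.property V).of_injective _ hinj, ?_, ?_, ?_⟩
      · have : (((V.toSubgroup.comap f).comap i₁ : Subgroup _) : Set G₁.obj) =
            toHom s.inl ⁻¹' (V.toSubgroup : Set s.pt.obj) := by
          ext a
          simp [hf₁]
        change IsOpen (((V.toSubgroup.comap f).comap i₁ : Subgroup _) : Set G₁.obj)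
        rw [this]
        exact V.isOpen'.preimage (toHom s.inl).continuous_toFun
      · have : (((V.toSubgroup.comap f).comap i₂ : Subgroup _) : Set G₂.obj) =
            toHom s.inr ⁻¹' (V.toSubgroup : Set s.pt.obj) := by
          ext a
          simp [hf₂]
        change IsOpen (((V.toSubgroup.comap f).comap i₂ : Subgroup _) : Set G₂.obj)
        rw [this]
        exact V.isOpen'.preimage (toHom s.inr).continuous_toFun
      · intro h
        change f _ ∈ V.toSubgroup
        have h1 : toHom s.inl (toHom φ₁ h) = toHom s.inr (toHom φ₂ h) :=
          DFunLike.congr_fun (congrArg toHom s.condition) h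
        rw [map_mul, map_inv, hf₁, hf₂, h1, mul_inv_cancel]
        exact V.toSubgroup.one_mem
    refine ⟨ofHom F, hom_ext fun a => ?_, hom_ext fun a => ?_⟩
    · exact (hF _).trans (hf₁ a)
    · exact (hF _).trans (hf₂ a)
  choose desc hd₁ hd₂ using hdesc
  refine Limits.PushoutCocone.IsColimit.mk hw desc hd₁ hd₂ fun s m hm₁ hm₂ => ?_
  refine hom_ext (DFunLike.congr_fun (DFunLike.coe_injective ?_))
  refine hι.equalizer (toHom m).continuous_toFun (toHom (desc s)).continuous_toFun ?_
  have key : (toHom m).toMonoidHom.comp ι = (toHom (desc s)).toMonoidHom.comp ι := by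
    refine Monoid.Coprod.hom_ext (MonoidHom.ext fun a => ?_) (MonoidHom.ext fun a => ?_)
    · exact DFunLike.congr_fun (congrArg toHom (hm₁.trans (hd₁ s).symm)) a
    · exact DFunLike.congr_fun (congrArg toHom (hm₂.trans (hd₂ s).symm)) a
  exact funext fun γ => DFunLike.congr_fun key γ

end Pushout

/-! ### Finite `p`-quotients and separation. -/

section Main

/-- Past level `m` the image of the series is trivial, whence the `min`. This reduces comparing
filtrations on the quotient of `H` to comparing them on `H`. -/
theorem mk_mem_map_lowerPCentral {p : ℕ} {G : Type*} [Group G] [TopologicalSpace G]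
    [IsTopologicalGroup G] (m j : ℕ) (x : G) :
    (x : G ⧸ lowerPCentral p G m) ∈
      (lowerPCentral p G j).map (QuotientGroup.mk' (lowerPCentral p G m)) ↔
      x ∈ lowerPCentral p G (min j m) := by
  have h1 : (x : G ⧸ lowerPCentral p G m) ∈
      (lowerPCentral p G j).map (QuotientGroup.mk' (lowerPCentral p G m)) ↔
      x ∈ lowerPCentral p G m ⊔ lowerPCentral p G j := by
    rw [← QuotientGroup.comap_map_mk']
    rfl
  rw [h1]
  have hF := (isPCentralFiltration_lowerPCentral (p := p) (G := G)).anti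
  rcases le_total j m with h | h
  · rw [sup_eq_right.2 (hF h), min_eq_left h]
  · rw [sup_eq_left.2 (hF h), min_eq_right h]

/-- Uniform groups amalgamated along a common uniform subgroup to which their lower `p`-central
series restrict have compatible homomorphisms to finite `p`-groups with prescribed small kernels. -/
theorem exists_finite_isPGroup_amalgam {p : ℕ} [Fact p.Prime] {G₁ G₂ H : Type u} [Group G₁]
    [TopologicalSpace G₁] [IsTopologicalGroup G₁] [CompactSpace G₁] [Group G₂]
    [TopologicalSpace G₂] [IsTopologicalGroup G₂] [CompactSpace G₂] [Group H] [TopologicalSpace H]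
    [IsTopologicalGroup H] (φ₁ : H →ₜ* G₁) (φ₂ : H →ₜ* G₂)
    (h₁ : ∀ i, (lowerPCentral p G₁ i).comap φ₁.toMonoidHom = lowerPCentral p H i)
    (h₂ : ∀ i, (lowerPCentral p G₂ i).comap φ₂.toMonoidHom = lowerPCentral p H i) (m : ℕ)
    (ho₁ : IsOpen (lowerPCentral p G₁ m : Set G₁)) (ho₂ : IsOpen (lowerPCentral p G₂ m : Set G₂)) :
    ∃ (Q : Type u) (_ : Group Q) (_ : Finite Q), IsPGroup p Q ∧ ∃ (α : G₁ →* Q) (β : G₂ →* Q),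
      α.ker = lowerPCentral p G₁ m ∧ β.ker = lowerPCentral p G₂ m ∧
      ∀ h, α (φ₁ h) = β (φ₂ h) := by
  have : Finite (G₁ ⧸ lowerPCentral p G₁ m) := Subgroup.quotient_finite_of_isOpen _ ho₁
  have : Finite (G₂ ⧸ lowerPCentral p G₂ m) := Subgroup.quotient_finite_of_isOpen _ ho₂
  let f₁ : H ⧸ lowerPCentral p H m →* G₁ ⧸ lowerPCentral p G₁ m :=
    QuotientGroup.map _ _ φ₁.toMonoidHom (h₁ m).ge
  let f₂ : H ⧸ lowerPCentral p H m →* G₂ ⧸ lowerPCentral p G₂ m :=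
    QuotientGroup.map _ _ φ₂.toMonoidHom (h₂ m).ge
  have hf₁ : Function.Injective f₁ := by
    rw [injective_iff_map_eq_one]
    intro v hv
    obtain ⟨x, rfl⟩ := QuotientGroup.mk_surjective v
    exact (QuotientGroup.eq_one_iff x).2 ((h₁ m).le ((QuotientGroup.eq_one_iff (φ₁ x)).1 hv))
  have hcomap : ∀ j, ((lowerPCentral p G₁ j).map (QuotientGroup.mk' (lowerPCentral p G₁ m))).comap f₁
      = ((lowerPCentral p G₂ j).map (QuotientGroup.mk' (lowerPCentral p G₂ m))).comap f₂ := by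
    intro j
    ext v
    obtain ⟨x, rfl⟩ := QuotientGroup.mk_surjective v
    have e₁ := mk_mem_map_lowerPCentral (p := p) m j (φ₁ x)
    have e₂ := mk_mem_map_lowerPCentral (p := p) m j (φ₂ x)
    exact e₁.trans ((SetLike.ext_iff.1 ((h₁ (min j m)).trans (h₂ (min j m)).symm) x).trans e₂.symm)
  obtain ⟨Q, hQ, hQf, hQp, α, β, hα, hβ, hαβ⟩ := exists_isPGroup_amalgam (m := m)
    (isPCentralFiltration_lowerPCentral.map _ (QuotientGroup.mk'_surjective (lowerPCentral p G₁ m)))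
    (isPCentralFiltration_lowerPCentral.map _ (QuotientGroup.mk'_surjective (lowerPCentral p G₂ m)))
    f₁ f₂ hf₁ hcomap (QuotientGroup.map_mk'_self _) (QuotientGroup.map_mk'_self _)
  refine ⟨Q, hQ, hQf, hQp, α.comp (QuotientGroup.mk' _), β.comp (QuotientGroup.mk' _), ?_, ?_,
    fun h => DFunLike.congr_fun hαβ (h : H ⧸ lowerPCentral p H m)⟩
  · rw [← MonoidHom.comap_ker, (MonoidHom.ker_eq_bot_iff α).2 hα, MonoidHom.comap_bot,
      QuotientGroup.ker_mk']
  · rw [← MonoidHom.comap_ker, (MonoidHom.ker_eq_bot_iff β).2 hβ, MonoidHom.comap_bot,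
      QuotientGroup.ker_mk']

end Main

theorem mainTheorem10 (p : ℕ) [Fact p.Prime] (d k n : ℕ)
    (hd : 1 ≤ d) (hdk : d ≤ k) (hkn : k ≤ n)
    (G₁ G₂ H : ProPGrp.{u} p)
    (hG₁ : IsUniformProPGroup p G₁.obj) (hG₂ : IsUniformProPGroup p G₂.obj) (hH : IsUniformProPGroup p H.obj)
    (φ₁ : H ⟶ G₁) (φ₂ : H ⟶ G₂)
    (hφ₁ : Function.Injective (ProPGrp.toHom φ₁)) (hφ₂ : Function.Injective (ProPGrp.toHom φ₂))
    (x : ℕ → G₁.obj) (y : ℕ → G₂.obj) (z : ℕ → H.obj)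
    (hx : IsGeneratingBasis (Finset.Icc 1 k) x)
    (hy : IsGeneratingBasis (Finset.Icc d n) y)
    (hz : closedSpan (z '' (Finset.Icc d k : Set ℕ)) = ⊤)
    (hzx : ∀ i ∈ Finset.Icc d k, ProPGrp.toHom φ₁ (z i) = x i)
    (hzy : ∀ i ∈ Finset.Icc d k, ProPGrp.toHom φ₂ (z i) = y i) :
    AmalgamIsProper φ₁ φ₂ := by
  refine ⟨ProPGrp.exists_isPushout φ₁ φ₂, fun G ψ₁ ψ₂ hpush => ?_⟩
  have h₁ := comap_lowerPCentral_of_basis hG₁ G₁.property hH (ProPGrp.toHom φ₁)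
    (Finset.Icc_subset_Icc_left hd) hx hz hzx
  have h₂ := comap_lowerPCentral_of_basis hG₂ G₂.property hH (ProPGrp.toHom φ₂)
    (Finset.Icc_subset_Icc_right hkn) hy hz hzy
  have key : ∀ m, (∀ g, ProPGrp.toHom ψ₁ g = 1 → g ∈ lowerPCentral p G₁.obj m) ∧
      ∀ g, ProPGrp.toHom ψ₂ g = 1 → g ∈ lowerPCentral p G₂.obj m := by
    intro m
    have ho₁ := hG₁.isOpen_lowerPCentral m
    have ho₂ := hG₂.isOpen_lowerPCentral m
    obtain ⟨Q, _, _, hQp, α, β, hα, hβ, hαβ⟩ := exists_finite_isPGroup_amalgam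
      (ProPGrp.toHom φ₁) (ProPGrp.toHom φ₂) h₁ h₂ m ho₁ ho₂
    let _ : TopologicalSpace Q := ⊥
    have : DiscreteTopology Q := ⟨rfl⟩
    -- The discrete group `Q` receives a map from the pushout, so whatever `ψ₁` or `ψ₂` kills lies
    -- in `P m`.
    let P : ProPGrp.{u} p := ⟨ProfiniteGrp.of Q, fun U => hQp.to_quotient U.toSubgroup⟩
    let a : G₁ ⟶ P := ProPGrp.ofHom ⟨α, α.continuous_of_isOpen_ker (hα ▸ ho₁)⟩
    let b : G₂ ⟶ P := ProPGrp.ofHom ⟨β, β.continuous_of_isOpen_ker (hβ ▸ ho₂)⟩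
    have hab : φ₁ ≫ a = φ₂ ≫ b := ProPGrp.hom_ext hαβ
    refine ⟨fun g hg => ?_, fun g hg => ?_⟩
    · rw [← hα, MonoidHom.mem_ker]
      have h3 := DFunLike.congr_fun (congrArg ProPGrp.toHom (hpush.inl_desc a b hab)) g
      have h4 : ProPGrp.toHom (hpush.desc a b hab) (ProPGrp.toHom ψ₁ g) = α g := h3
      rw [← h4, hg, map_one]
    · rw [← hβ, MonoidHom.mem_ker]
      have h3 := DFunLike.congr_fun (congrArg ProPGrp.toHom (hpush.inr_desc a b hab)) g
      have h4 : ProPGrp.toHom (hpush.desc a b hab) (ProPGrp.toHom ψ₂ g) = β g := h3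
      rw [← h4, hg, map_one]
  -- The series of a pro-`p` group enters every neighbourhood of `1`, so it has trivial
  -- intersection.
  have hsep : ∀ (A : ProPGrp.{u} p) (g : A.obj), (∀ m, g ∈ lowerPCentral p A.obj m) → g = 1 := by
    intro A g hg
    by_contra hne
    obtain ⟨i, hi⟩ := exists_lowerPCentral_subset A.property (isOpen_compl_singleton (x := g))
      (fun h => hne h.symm)
    exact hi (hg i) rfl
  exact ⟨(injective_iff_map_eq_one _).2 fun g hg => hsep G₁ g fun m => (key m).1 g hg,
    (injective_iff_map_eq_one _).2 fun g hg => hsep G₂ g fun m => (key m).2 g hg⟩
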